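/- Let $\ell\ge 3$, let $K$ be the $(2\ell+1)\times(2\ell+1)$ matrix with ones on the anti-diagonal and zeroes elsewhere, and let $G=\mathrm{SO}_{2\ell+1}(\mathbb C)=\{g\in \mathrm{SL}_{2\ell+1}(\mathbb C) : g=(Kg^{-1}K)^T\}$, a group of type $B_\ell$. Let $A$ be its diagonal torus. Identify $X_*(A)$ with $\mathbb Z^\ell$, where $a=(a_1,\dots,a_\ell)$ is the cocharacter $z\mapsto \mathrm{Diag}(z^{a_1},\dots,z^{a_\ell},1,z^{-a_\ell},\dots,z^{-a_1})$, and $V=X_*(A)\otimes\mathbb R$ with $\mathbb R^\ell$. The simple roots are $\gamma_k=e_k-e_{k+1}$ ($1\le k<\ell$) and $\gamma_\ell=e_\ell$, the highest root is $\tilde\gamma_0=\gamma_1+2\gamma_2+\dots+2\gamma_\ell$, and $\gamma_0=1-\tilde\gamma_0$ is the affine node of the affine Dynkin diagram. Put $b_0=b_1=1$, $b_k=2$ for $2\le k\le \ell$, $v_0=0$ and $v_k=\frac1{b_k}(e_1+\dots+e_k)$ for $1\le k\le\ell$; these are the vertices of the closed alcove $\bar C=\{x\in V:\gamma_k(x)\ge0\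 (1\le k\le\ell),\ \tilde\gamma_0(x)\le1\}$. Let $g\in G$ have finite order $m$ and let $\xi$ be a primitive $m$-th root of unity. A Kac diagram of $g$ (with respect to $\xi$) is a labelling of the nodes $\gamma_0,\dots,\gamma_\ell$ obtained as follows: choose $h\in G$ and $a\in X_*(A)$ such that $h^{-1}gh=a(\xi)$ and $a/m\in\bar C$, write $a/m=\frac1m\sum_{k=0}^{\ell}r_kb_kv_k$ with integers $r_k\ge0$ and $m=\sum_{k=0}^\ell r_kb_k$, and divide all $r_k$ by their greatest common divisor. For $1\le k<\ell$ let $s_k\in G$ be the permutation matrix that interchanges the indices $k,k+1$ and the indices $2\ell-k+1,2\ell-k+2$. Let $t_\ell\in G$ be the matrix that interchanges the indices $\ell,\ell+2$, has entry $-1$ at $(\ell+1,\ell+1)$, and is the identity elsewhere. For $1\le k<\ell$ put $t_k=s_ks_{k+1}\cdots s_{\ell-1}\,t_\ell\, s_{\ell-1}\cdots s_{k+1}s_k$. For a partition $\vec\ell=(\ell_\mu\ge\dots\ge\ell_1)$ of $\ell$ put $\ell'_\nu=\ell_1+\dots+\ell_{\nu-1}$ and $$n_{\vec\ell}=\prod_{\nu=1}^{\mu}\bigl(s_{\ell'_\nu+1}s_{\ell'_\nu+2}\cdots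 s_{\ell'_\nu+\ell_\nu-1}\,t_{\ell'_\nu+\ell_\nu}\bigr)\in G,$$ the product being taken in the order $\nu=1,2,\dots,\mu$. (This is the standard representative in $G$ of the elliptic conjugacy class of the Weyl group that is attached to $\vec\ell$.) Lemma. Fix a partition $\vec\ell=(\ell_\mu\ge\dots\ge\ell_1)$ of $\ell\ge3$ and let $m=2\,\mathrm{lcm}(\ell_1,\dots,\ell_\mu)$. Append $\lceil\mu/2\rceil$ copies of $m/2$ and $\lfloor\mu/2\rfloor$ zeroes to the list $\bigl(a\,m/(2\ell_\nu) : 1\le\nu\le\mu,\ 1\le a\le\ell_\nu-1\bigr)$, and arrange the result in decreasing order $\sigma_1\ge\sigma_2\ge\dots\ge\sigma_\ell$. Then, with respect to every primitive $m$-th root of unity, the element $n_{\vec\ell}$ (which has order $m$) has exactly one Kac diagram. It is obtained from the labels $$m-(\sigma_1+\sigma_2)\ \text{on } \gamma_0,\qquad \sigma_k-\sigma_{k+1}\ \text{on } \gamma_k\ (1\le k\le\ell-1),\qquad \sigma_\ell\ \text{on } \gamma_\ell$$ by dividing all of them by their greatest common divisor. -/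

import Mathlib

/-! Kac diagrams of finite order elements in the complex group `SO_{2ℓ+1}` of type `B_ℓ`.
Matrix rows and columns are numbered `1, …, 2ℓ+1` in the comments; the index `i : Fin (2 * ℓ + 1)`
stands for row `i + 1`.  The nodes `γ₀, γ₁, …, γ_ℓ` of the affine Dynkin diagram are indexed by
`Fin (ℓ + 1)`, with `0` the affine node. -/

namespace KacB

open Matrix

abbrev Mat (ℓ : ℕ) := Matrix (Fin (2 * ℓ + 1)) (Fin (2 * ℓ + 1)) ℂ

abbrev SL (ℓ : ℕ) := Matrix.SpecialLinearGroup (Fin (2 * ℓ + 1)) ℂ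

/-- The matrix with ones on the anti-diagonal and zeroes elsewhere. -/
def K (ℓ : ℕ) : Mat ℓ :=
  Matrix.of fun i j => if (i : ℕ) + j = 2 * ℓ then 1 else 0

theorem K_eq (ℓ : ℕ) : K ℓ = (Fin.revPerm : Equiv.Perm (Fin (2 * ℓ + 1))).permMatrix ℂ := by
  ext i j
  simp only [K, Matrix.of_apply, Equiv.Perm.permMatrix, Equiv.toPEquiv_apply,
    PEquiv.toMatrix_apply, Fin.revPerm_apply, Option.mem_some_iff, Fin.ext_iff, Fin.val_rev]
  congr 1
  exact propext ⟨fun h => by omega, fun h => by omega⟩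

theorem K_mul_K (ℓ : ℕ) : K ℓ * K ℓ = 1 := by
  rw [K_eq, ← Matrix.permMatrix_mul]
  have : (Fin.revPerm : Equiv.Perm (Fin (2 * ℓ + 1))) * Fin.revPerm = 1 := by
    ext i; simp
  rw [this, Matrix.permMatrix_one]

theorem K_transpose (ℓ : ℕ) : (K ℓ)ᵀ = K ℓ := by
  ext i j
  simp [K, add_comm]

/-- `SO_{2ℓ+1}(ℂ)`, realized as those `g` in `SL_{2ℓ+1}(ℂ)` with `g = (K g⁻¹ K)ᵀ`. -/
def SO (ℓ : ℕ) : Subgroup (SL ℓ) where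
  carrier := {g | (g : Mat ℓ) = (K ℓ * ((g⁻¹ : SL ℓ) : Mat ℓ) * K ℓ)ᵀ}
  one_mem' := by simp [K_transpose, K_mul_K]
  mul_mem' := by
    intro a b ha hb
    simp only [Set.mem_ofPred_eq] at ha hb ⊢
    rw [_root_.mul_inv_rev, Matrix.SpecialLinearGroup.coe_mul, Matrix.SpecialLinearGroup.coe_mul]
    conv_lhs => rw [ha, hb]
    rw [← Matrix.transpose_mul]
    congr 1
    calc K ℓ * ((b⁻¹ : SL ℓ) : Mat ℓ) * K ℓ * (K ℓ * ((a⁻¹ : SL ℓ) : Mat ℓ) * K ℓ)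
        = K ℓ * ((b⁻¹ : SL ℓ) : Mat ℓ) * (K ℓ * K ℓ) * ((a⁻¹ : SL ℓ) : Mat ℓ) * K ℓ := by simp only [Matrix.mul_assoc]
      _ = _ := by rw [K_mul_K, Matrix.mul_one]; simp only [Matrix.mul_assoc]
  inv_mem' := by
    intro a ha
    simp only [Set.mem_ofPred_eq, inv_inv] at ha ⊢
    conv_rhs => rw [ha]
    simp only [Matrix.transpose_mul, Matrix.transpose_transpose, K_transpose]
    calc ((a⁻¹ : SL ℓ) : Mat ℓ) = 1 * ((a⁻¹ : SL ℓ) : Mat ℓ) * 1 := by simp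
      _ = K ℓ * K ℓ * ((a⁻¹ : SL ℓ) : Mat ℓ) * (K ℓ * K ℓ) := by rw [K_mul_K]
      _ = _ := by simp only [Matrix.mul_assoc]

theorem mem_SO_of {ℓ : ℕ} {M : Mat ℓ} (hd : M.det = 1)
    (h : M * (K ℓ * Mᵀ * K ℓ) = 1) :
    (⟨M, hd⟩ : SL ℓ) ∈ SO ℓ := by
  set g : SL ℓ := ⟨M, hd⟩ with hg
  have h1 : ((g⁻¹ : SL ℓ) : Mat ℓ) * M = 1 := by
    have : ((g⁻¹ * g : SL ℓ) : Mat ℓ) = 1 := by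
      rw [inv_mul_cancel, Matrix.SpecialLinearGroup.coe_one]
    rwa [Matrix.SpecialLinearGroup.coe_mul] at this
  have h2 : ((g⁻¹ : SL ℓ) : Mat ℓ) = K ℓ * Mᵀ * K ℓ := left_inv_eq_right_inv h1 h
  change M = (K ℓ * ((g⁻¹ : SL ℓ) : Mat ℓ) * K ℓ)ᵀ
  rw [h2]
  have : K ℓ * (K ℓ * Mᵀ * K ℓ) * K ℓ = Mᵀ := by
    calc _ = (K ℓ * K ℓ) * Mᵀ * (K ℓ * K ℓ) := by simp only [Matrix.mul_assoc]
      _ = Mᵀ := by simp [K_mul_K]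
  rw [this, Matrix.transpose_transpose]

/-! ### The Weyl group representatives -/

/-- The matrix `s_k` (for `1 ≤ k < ℓ`): it interchanges `k, k+1` and `2ℓ-k+1, 2ℓ-k+2`. -/
def sMat (ℓ k : ℕ) : Mat ℓ :=
  Matrix.of fun i j =>
    let r := (i : ℕ) + 1
    let c := (j : ℕ) + 1
    if r = c ∧ r ∉ ({k, k + 1, 2 * ℓ - k + 2, 2 * ℓ - k + 1} : Finset ℕ) then 1
    else if r ≠ c ∧ r ∈ ({k, k + 1} : Finset ℕ) ∧ c ∈ ({k, k + 1} : Finset ℕ) then 1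
    else if r ≠ c ∧ r ∈ ({2 * ℓ - k + 1, 2 * ℓ - k + 2} : Finset ℕ) ∧
      c ∈ ({2 * ℓ - k + 1, 2 * ℓ - k + 2} : Finset ℕ) then 1
    else 0

/-- The matrix `t_ℓ` (for `1 ≤ ℓ`): it interchanges `ℓ, ℓ+2` and has `-1` at `ℓ+1`. -/
def tMat (ℓ : ℕ) : Mat ℓ :=
  Matrix.of fun i j =>
    let r := (i : ℕ) + 1
    let c := (j : ℕ) + 1
    if r = c ∧ (r < ℓ ∨ ℓ + 2 < r) then 1
    else if r ≠ c ∧ r ∈ ({ℓ, ℓ + 2} : Finset ℕ) ∧ c ∈ ({ℓ, ℓ + 2} : Finset ℕ) then 1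
    else if r = ℓ + 1 ∧ c = ℓ + 1 then -1
    else 0

/-- The permutation of the indices behind `s_k`. -/
def sPerm {ℓ k : ℕ} (h1 : 1 ≤ k) (h2 : k < ℓ) : Equiv.Perm (Fin (2 * ℓ + 1)) :=
  Equiv.swap ⟨k - 1, by omega⟩ ⟨k, by omega⟩ *
    Equiv.swap ⟨2 * ℓ - k, by omega⟩ ⟨2 * ℓ - k + 1, by omega⟩

theorem sPerm_val {ℓ k : ℕ} (h1 : 1 ≤ k) (h2 : k < ℓ) (i : Fin (2 * ℓ + 1)) :
    (sPerm h1 h2 i : ℕ) = if (i : ℕ) = k - 1 then k else if (i : ℕ) = k then k - 1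
      else if (i : ℕ) = 2 * ℓ - k then 2 * ℓ - k + 1
      else if (i : ℕ) = 2 * ℓ - k + 1 then 2 * ℓ - k else i := by
  obtain ⟨i, hi⟩ := i
  simp only [sPerm, Equiv.Perm.mul_apply, Equiv.swap_apply_def, Fin.mk.injEq]
  by_cases a1 : i = 2 * ℓ - k
  · simp only [a1, if_true, Fin.mk.injEq]; split_ifs <;> first | rfl | omega
  by_cases a2 : i = 2 * ℓ - k + 1
  · have b1 : ¬ 2 * ℓ - k + 1 = 2 * ℓ - k := by omega
    have b2 : ¬ 2 * ℓ - k = k - 1 := by omega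
    have b3 : ¬ 2 * ℓ - k = k := by omega
    have b4 : ¬ 2 * ℓ - k + 1 = k - 1 := by omega
    have b5 : ¬ 2 * ℓ - k + 1 = k := by omega
    simp only [a2, b1, b2, b3, b4, b5, if_true, if_false, Fin.mk.injEq]
  simp only [a1, a2, if_false, Fin.mk.injEq]; split_ifs <;> rfl

theorem sMat_eq {ℓ k : ℕ} (h1 : 1 ≤ k) (h2 : k < ℓ) :
    sMat ℓ k = (sPerm h1 h2).permMatrix ℂ := by
  ext i j
  have hi := i.2
  have hj := j.2
  simp only [sMat, Matrix.of_apply, Equiv.Perm.permMatrix, Equiv.toPEquiv_apply,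
    PEquiv.toMatrix_apply, Option.mem_some_iff, Fin.ext_iff, sPerm_val,
    Finset.mem_insert, Finset.mem_singleton]
  generalize (i : ℕ) = x at *
  generalize (j : ℕ) = y at *
  by_cases a1 : x = k - 1
  · rw [if_pos a1]; split_ifs <;> first | rfl | (exfalso; omega)
  by_cases a2 : x = k
  · rw [if_neg a1, if_pos a2]; split_ifs <;> first | rfl | (exfalso; omega)
  by_cases a3 : x = 2 * ℓ - k
  · rw [if_neg a1, if_neg a2, if_pos a3]; split_ifs <;> first | rfl | (exfalso; omega)
  by_cases a4 : x = 2 * ℓ - k + 1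
  · rw [if_neg a1, if_neg a2, if_neg a3, if_pos a4]
    split_ifs <;> first | rfl | (exfalso; omega)
  rw [if_neg a1, if_neg a2, if_neg a3, if_neg a4]
  split_ifs <;> first | rfl | (exfalso; omega)

theorem sMat_spec {ℓ k : ℕ} (h1 : 1 ≤ k) (h2 : k < ℓ) :
    (sMat ℓ k).det = 1 ∧ sMat ℓ k * (K ℓ * (sMat ℓ k)ᵀ * K ℓ) = 1 := by
  rw [sMat_eq h1 h2]
  constructor
  · rw [Matrix.det_permutation, sPerm, map_mul, Equiv.Perm.sign_swap, Equiv.Perm.sign_swap]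
    · simp
    · simp [Fin.ext_iff]
    · simp only [ne_eq, Fin.ext_iff]; omega
  · have hc : Fin.revPerm * sPerm h1 h2 = sPerm h1 h2 * Fin.revPerm := by
      ext i
      have hi := i.2
      simp only [Equiv.Perm.mul_apply, Fin.revPerm_apply, Fin.val_rev, sPerm_val]
      split_ifs <;> omega
    have hr : (Fin.revPerm : Equiv.Perm (Fin (2 * ℓ + 1))) * Fin.revPerm = 1 := by
      ext i; simp
    rw [K_eq, Matrix.transpose_permMatrix, ← Matrix.permMatrix_mul, ← Matrix.permMatrix_mul,
      ← Matrix.permMatrix_mul, ← Matrix.permMatrix_one]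
    congr 1
    calc _ = Fin.revPerm * ((sPerm h1 h2)⁻¹ * (Fin.revPerm * sPerm h1 h2)) := by group
      _ = Fin.revPerm * Fin.revPerm := by rw [hc]; group
      _ = 1 := hr

/-- The element `s_k` of `SO_{2ℓ+1}` for `1 ≤ k < ℓ` (other values of `k` are not used). -/
def s (ℓ k : ℕ) : SO ℓ :=
  if h : 1 ≤ k ∧ k < ℓ then
    ⟨⟨sMat ℓ k, (sMat_spec h.1 h.2).1⟩, mem_SO_of (sMat_spec h.1 h.2).1 (sMat_spec h.1 h.2).2⟩
  else 1

theorem tMat_eq {ℓ : ℕ} (h1 : 1 ≤ ℓ) :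
    tMat ℓ = Matrix.diagonal (fun i : Fin (2 * ℓ + 1) => if i = ⟨ℓ, by omega⟩ then (-1 : ℂ) else 1) *
      (Equiv.swap (⟨ℓ - 1, by omega⟩ : Fin (2 * ℓ + 1)) ⟨ℓ + 1, by omega⟩).permMatrix ℂ := by
  ext i j
  obtain ⟨i, hi⟩ := i
  obtain ⟨j, hj⟩ := j
  simp only [tMat, Matrix.of_apply, Matrix.diagonal_mul, Equiv.Perm.permMatrix,
    Equiv.toPEquiv_apply, PEquiv.toMatrix_apply, Option.mem_some_iff, Equiv.swap_apply_def,
    Finset.mem_insert, Finset.mem_singleton, Fin.ext_iff]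
  obtain ⟨l, rfl⟩ : ∃ l, ℓ = l + 1 := ⟨ℓ - 1, by omega⟩
  simp only [Nat.add_sub_cancel]
  by_cases a1 : i = l
  · simp only [a1, if_true, true_or, true_and]
    split_ifs <;> first | (exfalso; omega) | simp
  by_cases a2 : i = l + 1 + 1
  · simp only [a2, if_true]; split_ifs <;> simp_all <;> omega
  simp only [a1, a2, if_false]
  split_ifs <;> (simp_all; try omega)

theorem tMat_spec {ℓ : ℕ} (h1 : 1 ≤ ℓ) :
    (tMat ℓ).det = 1 ∧ tMat ℓ * (K ℓ * (tMat ℓ)ᵀ * K ℓ) = 1 := by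
  rw [tMat_eq h1]
  set D := Matrix.diagonal (fun i : Fin (2 * ℓ + 1) => if i = ⟨ℓ, by omega⟩ then (-1 : ℂ) else 1)
    with hD
  set P := (Equiv.swap (⟨ℓ - 1, by omega⟩ : Fin (2 * ℓ + 1)) ⟨ℓ + 1, by omega⟩).permMatrix ℂ
    with hP
  constructor
  · rw [Matrix.det_mul, hP, Matrix.det_permutation, Equiv.Perm.sign_swap, hD, Matrix.det_diagonal,
      Finset.prod_ite_eq' Finset.univ]
    · simp
    · simp only [ne_eq, Fin.ext_iff]; omega
  · have hDD : D * D = 1 := by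
      rw [hD, Matrix.diagonal_mul_diagonal, ← Matrix.diagonal_one]
      congr 1; ext i; split_ifs <;> simp
    have hKD : K ℓ * D = D * K ℓ := by
      ext i j
      obtain ⟨i, hi⟩ := i
      obtain ⟨j, hj⟩ := j
      simp only [hD, K, Matrix.mul_diagonal, Matrix.diagonal_mul, Matrix.of_apply, Fin.ext_iff]
      split_ifs <;> simp_all <;> omega
    have hPK : P * (K ℓ * P * K ℓ) = 1 := by
      rw [hP, K_eq, ← Matrix.permMatrix_mul, ← Matrix.permMatrix_mul,
        ← Matrix.permMatrix_mul, ← Matrix.permMatrix_one]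
      congr 1
      ext i
      obtain ⟨i, hi⟩ := i
      simp only [Equiv.Perm.mul_apply, Equiv.swap_apply_def, Fin.revPerm_apply, Fin.ext_iff,
        Fin.val_rev, Equiv.Perm.one_apply]
      split_ifs <;> simp_all <;> omega
    have hPt : Pᵀ = P := by rw [hP, Matrix.transpose_permMatrix, Equiv.swap_inv]
    have hDt : Dᵀ = D := by rw [hD, Matrix.diagonal_transpose]
    rw [Matrix.transpose_mul, hPt, hDt]
    calc D * P * (K ℓ * (P * D) * K ℓ) = D * (P * (K ℓ * P * (D * K ℓ))) := by
          simp only [Matrix.mul_assoc]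
      _ = D * (P * (K ℓ * P * K ℓ)) * D := by rw [← hKD]; simp only [Matrix.mul_assoc]
      _ = 1 := by rw [hPK, Matrix.mul_one, hDD]

/-- The element `t_ℓ` of `SO_{2ℓ+1}` for `1 ≤ ℓ` (the value for `ℓ = 0` is not used). -/
def tLast (ℓ : ℕ) : SO ℓ :=
  if h : 1 ≤ ℓ then ⟨⟨tMat ℓ, (tMat_spec h).1⟩, mem_SO_of (tMat_spec h).1 (tMat_spec h).2⟩ else 1

/-- `t_k = s_k s_{k+1} ⋯ s_{ℓ-1} · t_ℓ · s_{ℓ-1} ⋯ s_{k+1} s_k` for `1 ≤ k ≤ ℓ`. -/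
def t (ℓ k : ℕ) : SO ℓ :=
  ((List.range (ℓ - k)).map fun j => s ℓ (k + j)).prod * tLast ℓ *
    (((List.range (ℓ - k)).map fun j => s ℓ (k + j)).reverse).prod

/-- `c = s_{o+1} s_{o+2} ⋯ s_{o+d-1} · t_{o+d}`, the factor of a part `d` with offset `o`. -/
def c (ℓ o d : ℕ) : SO ℓ :=
  ((List.range (d - 1)).map fun j => s ℓ (o + j + 1)).prod * t ℓ (o + d)

/-- For parts `[d₁, d₂, …]` and offset `o`, the product of the factors `c` of the parts in this
order, where the offset of each part is `o` plus the sum of the parts before it. -/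
def nAux (ℓ : ℕ) : ℕ → List ℕ → SO ℓ
  | _, [] => 1
  | o, d :: L => c ℓ o d * nAux ℓ (o + d) L

/-- The element `n = c₁ c₂ ⋯ c_μ` attached to the partition `ℓ₁ ≤ ℓ₂ ≤ ⋯ ≤ ℓ_μ` of `ℓ`. -/
def n {ℓ : ℕ} (p : ℓ.Partition) : SO ℓ :=
  nAux ℓ 0 (p.parts.sort (· ≤ ·))

/-! ### Kac diagrams -/

/-- The exponents `(a₁, …, a_ℓ, 0, -a_ℓ, …, -a₁)`. -/
def expo {ℓ : ℕ} (a : Fin ℓ → ℤ) (i : Fin (2 * ℓ + 1)) : ℤ :=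
  if h : (i : ℕ) < ℓ then a ⟨i, h⟩
  else if h' : ℓ < (i : ℕ) then -a ⟨2 * ℓ - i, by omega⟩
  else 0

theorem expo_rev {ℓ : ℕ} (a : Fin ℓ → ℤ) (i : Fin (2 * ℓ + 1)) : expo a i.rev = -expo a i := by
  obtain ⟨i, hi⟩ := i
  rcases lt_trichotomy i ℓ with h | h | h
  · have h1 : ¬ 2 * ℓ - i < ℓ := by omega
    have h2 : ℓ < 2 * ℓ - i := by omega
    have h3 : 2 * ℓ - (2 * ℓ - i) = i := by omega
    simp [expo, Fin.val_rev, h, h1, h2, h3]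
  · subst h
    have h1 : 2 * i - i = i := by omega
    simp [expo, Fin.val_rev, h1]
  · have h1 : 2 * ℓ - i < ℓ := by omega
    have h2 : ¬ i < ℓ := by omega
    simp [expo, Fin.val_rev, h, h1, h2]

theorem det_coch {ℓ : ℕ} (a : Fin ℓ → ℤ) (z : ℂˣ) :
    (Matrix.diagonal fun i => ((z ^ expo a i : ℂˣ) : ℂ)).det = 1 := by
  have h0 : ∑ i, expo a i = 0 := by
    have h := Equiv.sum_comp (Fin.revPerm : Equiv.Perm (Fin (2 * ℓ + 1))) (expo a)
    simp only [Fin.revPerm_apply, expo_rev, Finset.sum_neg_distrib] at h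
    omega
  have h1 : ∏ i, z ^ expo a i = z ^ ∑ i, expo a i :=
    (map_sum (zmultiplesHom (Additive ℂˣ) (Additive.ofMul z)) (expo a) Finset.univ).symm
  rw [Matrix.det_diagonal, ← Units.coe_prod, h1, h0]
  simp

theorem coch_mul {ℓ : ℕ} (a : Fin ℓ → ℤ) (z : ℂˣ) :
    (Matrix.diagonal fun i => ((z ^ expo a i : ℂˣ) : ℂ)) *
      (K ℓ * (Matrix.diagonal fun i => ((z ^ expo a i : ℂˣ) : ℂ))ᵀ * K ℓ) = 1 := by
  have h : K ℓ * (Matrix.diagonal fun i => ((z ^ expo a i : ℂˣ) : ℂ)) =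
      (Matrix.diagonal fun i => ((z ^ (-expo a i) : ℂˣ) : ℂ)) * K ℓ := by
    ext i j
    simp only [Matrix.mul_diagonal, Matrix.diagonal_mul, K, Matrix.of_apply]
    split_ifs with hij
    · have : j = i.rev := by ext; simp only [Fin.val_rev]; omega
      rw [this, expo_rev]; ring
    · simp
  rw [Matrix.diagonal_transpose, h, Matrix.mul_assoc, K_mul_K, Matrix.mul_one,
    Matrix.diagonal_mul_diagonal, ← Matrix.diagonal_one]
  congr 1
  ext i
  rw [← Units.val_mul, ← _root_.zpow_add]
  simp

/-- The cocharacter group of the torus `A` of diagonal matrices of `SO_{2ℓ+1}` is `ℤ^ℓ`: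
`a = (a₁, …, a_ℓ)` is the cocharacter
`z ↦ Diag(z^{a₁}, …, z^{a_ℓ}, 1, z^{-a_ℓ}, …, z^{-a₁})`. -/
def coch {ℓ : ℕ} (a : Fin ℓ → ℤ) : ℂˣ →* SO ℓ where
  toFun z := ⟨⟨Matrix.diagonal fun i => ((z ^ expo a i : ℂˣ) : ℂ), det_coch a z⟩,
    mem_SO_of (det_coch a z) (coch_mul a z)⟩
  map_one' := by
    ext i j
    simp
  map_mul' z w := by
    apply Subtype.ext
    apply Subtype.ext
    change _ = Matrix.diagonal _ * Matrix.diagonal _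
    rw [Matrix.diagonal_mul_diagonal]
    change Matrix.diagonal _ = _
    exact congrArg _ (funext fun i => by rw [mul_zpow, Units.val_mul])

/-- The simple roots `α_k = e_k - e_{k+1}` for `k < ℓ` and `α_ℓ = e_ℓ`, as vectors of `ℝ^ℓ`;
the pairing with `V = X_*(A) ⊗ ℝ = ℝ^ℓ` is the dot product. -/
def simpleRoot {ℓ : ℕ} (k : Fin ℓ) : Fin ℓ → ℝ :=
  if h : (k : ℕ) + 1 < ℓ then Pi.single k 1 - Pi.single ⟨k + 1, h⟩ 1 else Pi.single k 1

/-- The constants `b_γ = c_γ` on the nodes of the affine diagram: `b₀ = b₁ = 1`, the others `2`. -/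
def b {ℓ : ℕ} (k : Fin (ℓ + 1)) : ℕ := if (k : ℕ) ≤ 1 then 1 else 2

/-- The highest root `α₁ + 2 α₂ + ⋯ + 2 α_ℓ`. -/
def highestRoot (ℓ : ℕ) : Fin ℓ → ℝ := ∑ k : Fin ℓ, (b k.succ : ℝ) • simpleRoot k

/-- The closure of the alcove `C` determined by the simple roots. -/
def closedAlcove (ℓ : ℕ) : Set (Fin ℓ → ℝ) :=
  {x | (∀ k, 0 ≤ simpleRoot k ⬝ᵥ x) ∧ highestRoot ℓ ⬝ᵥ x ≤ 1}

/-- The fundamental coweights `e₁ + ⋯ + e_k`. -/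
def coweight {ℓ : ℕ} (k : Fin ℓ) : Fin ℓ → ℝ := fun i => if i ≤ k then 1 else 0

/-- The vertices of the closed alcove: the origin, and the coweights divided by `b`. -/
noncomputable def vertex {ℓ : ℕ} : Fin (ℓ + 1) → (Fin ℓ → ℝ) :=
  Fin.cases 0 fun k => (1 / (b k.succ : ℝ)) • coweight k

/-- Division of all labels by their greatest common divisor. -/
def reduce {ℓ : ℕ} (r : Fin (ℓ + 1) → ℤ) : Fin (ℓ + 1) → ℤ := fun k => r k / Finset.univ.gcd r

/-- `y` is a Kac diagram of `g ∈ SO_{2ℓ+1}` with respect to the primitive root of unity `ξ` whose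
order is the order `m` of `g`: there are `h` in the group and a cocharacter `a` such that
`h⁻¹ g h = a(ξ)` and `a / m` lies in the closed alcove, and `y` is obtained by removing common
factors from non-negative integers `r_γ` with `a / m = ∑ (r_γ b_γ / m) v_γ` and
`m = ∑ r_γ b_γ`. -/
def IsKacDiagram {ℓ : ℕ} (ξ : ℂˣ) (g : SO ℓ) (y : Fin (ℓ + 1) → ℤ) : Prop :=
  0 < orderOf g ∧ IsPrimitiveRoot ξ (orderOf g) ∧
  ∃ (h : SO ℓ) (a : Fin ℓ → ℤ) (r : Fin (ℓ + 1) → ℤ),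
    h⁻¹ * g * h = coch a ξ ∧
    (fun i => (a i : ℝ) / orderOf g) ∈ closedAlcove ℓ ∧
    (∀ k, 0 ≤ r k) ∧
    (fun i => (a i : ℝ) / orderOf g) =
      ∑ k, ((r k : ℝ) * b k / orderOf g) • vertex k ∧
    (orderOf g : ℤ) = ∑ k, r k * b k ∧
    y = reduce r

/-! ### The labels attached to a partition -/

/-- `m = 2 lcm(ℓ₁, …, ℓ_μ)`. -/
def m {ℓ : ℕ} (p : ℓ.Partition) : ℕ := 2 * p.parts.lcm

/-- The numbers `a m / (2 d)`, for `d` a part and `1 ≤ a ≤ d - 1` (these divisions are exact),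
together with `⌈μ/2⌉` copies of `m / 2` and `⌊μ/2⌋` zeroes. -/
def sigmaMultiset {ℓ : ℕ} (p : ℓ.Partition) : Multiset ℕ :=
  (p.parts.bind fun d => (Finset.Icc 1 (d - 1)).val.map fun a => a * m p / (2 * d)) +
    Multiset.replicate ((p.parts.card + 1) / 2) (m p / 2) +
    Multiset.replicate (p.parts.card / 2) 0

/-- `σ_k` for `1 ≤ k ≤ ℓ`: the `k`-th entry of the list in decreasing order. -/
def sigma {ℓ : ℕ} (p : ℓ.Partition) (k : ℕ) : ℤ :=
  (((sigmaMultiset p).sort (· ≥ ·)).getD (k - 1) 0 : ℕ)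

/-- The labels `m - (σ₁ + σ₂)` on `γ₀`, `σ_k - σ_{k+1}` on `γ_k` for `1 ≤ k < ℓ`, and `σ_ℓ` on
`γ_ℓ`. -/
def labels {ℓ : ℕ} (p : ℓ.Partition) (k : Fin (ℓ + 1)) : ℤ :=
  if (k : ℕ) = 0 then (m p : ℤ) - (sigma p 1 + sigma p 2)
  else if (k : ℕ) < ℓ then sigma p k - sigma p (k + 1)
  else sigma p ℓ

end KacB

/-! Every row of `n p` has a single nonzero entry. The middle index is fixed with the sign `(-1)^μ`,
and each part `d` contributes one cycle of length `2 d` with all entries `1`, made of a block of `d`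
indices and its mirror image. A cyclic permutation is diagonalized by a Vandermonde matrix in roots
of unity, so the eigenvalues are `(-1)^μ` and, for each part `d`, all `2 d`-th roots of unity
(`nAux_diagonalizable`). Pairing each root with its inverse leaves one `1` and one `-1` per part.
Regrouping these with the middle eigenvalue gives exactly the spectrum of `coch (sigmaVec p) ξ`
(`prod_expo_sigmaVec`).

Equal spectra give similar matrices, and in the odd orthogonal group similarity implies conjugacy
(`exists_conj_of_similar`): if `P` intertwines two elements, divide it by a self-adjoint square root
of `P * adj P`, chosen as a polynomial in that matrix, and correct the determinant by a sign, which
odd size allows. So `n p` is conjugate to `coch (sigmaVec p) ξ`. Its order is then read off from the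
exponents. Since `σ` is decreasing with values in `[0, m/2]`, `σ/m` lies in the alcove, and
barycentric coordinates in the alcove are unique (`barycentric_iff`).

Uniqueness of the alcove point needs an argument, because conjugate torus elements can come from
different points of the alcove: `a₁ ↦ m - a₁` preserves the alcove, swaps the labels of `γ₀` and
`γ₁`, and yields a conjugate element. Here `-1` is an eigenvalue of the torus element in an
off-centre position, so some coordinate equals `m/2`. With `a₁ + a₂ ≤ m` this forces all coordinates
into `[0, m/2]` (`two_mul_le_of_alcove`). On that interval `x ↦ ξ^x + ξ^(-x)` is injective, so the
spectrum determines the coordinates up to order, and monotonicity fixes the order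
(`eq_sigmaVec_of_conj`). -/

namespace KacB

open Matrix Polynomial

/-! ### Square roots of invertible matrices -/

/-- A polynomial that is divisible by `X - C a` for all `a` in a multiset has a power that is
divisible by the product of these factors. -/
theorem prod_X_sub_C_dvd_pow {F : Type*} [CommRing F] (f : F[X]) (S : Multiset F)
    (h : ∀ a ∈ S, X - C a ∣ f) : (S.map fun a => X - C a).prod ∣ f ^ S.card := by
  induction S using Multiset.induction_on with
  | empty => simp
  | cons a S ih =>
    rw [Multiset.map_cons, Multiset.prod_cons, Multiset.card_cons, pow_succ']
    exact mul_dvd_mul (h a (Multiset.mem_cons_self a S))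
      (ih fun b hb => h b (Multiset.mem_cons_of_mem hb))

/-- Over an algebraically closed field of characteristic not two, the class of `X` modulo a monic
polynomial that does not vanish at zero is a square. -/
theorem exists_dvd_sq_sub_X {F : Type*} [Field F] [IsAlgClosed F] (h2 : (2 : F) ≠ 0) {q : F[X]}
    (hq : q.Monic) (h0 : q.coeff 0 ≠ 0) : ∃ f : F[X], q ∣ f ^ 2 - X := by
  classical
  choose w hw using fun z : F => IsAlgClosed.exists_pow_nat_eq z (n := 2) two_pos
  -- The interpolant squares to `a` at each root `a` of `q`, ignoring multiplicity. Hence `f ^ 2 -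
  -- X` is only nilpotent modulo `q`, and `f` is a first approximation.
  set f := Lagrange.interpolate q.roots.toFinset id w with hf
  have hdvd : ∀ a ∈ q.roots, X - C a ∣ f ^ 2 - X := by
    intro a ha
    rw [dvd_iff_isRoot]
    have : f.eval a = w a :=
      Lagrange.eval_interpolate_at_node (v := id) w (Function.injective_id.injOn)
        (Multiset.mem_toFinset.2 ha)
    simp [IsRoot, this, hw]
  have hnil : IsNilpotent (AdjoinRoot.mk q (f ^ 2 - X)) := by
    refine ⟨q.roots.card, ?_⟩
    rw [← map_pow, AdjoinRoot.mk_eq_zero]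
    conv_lhs => rw [(IsAlgClosed.splits q).eq_prod_roots_of_monic hq]
    exact prod_X_sub_C_dvd_pow _ _ hdvd
  have hroot : IsUnit (AdjoinRoot.mk q X) := by
    have h := congrArg (AdjoinRoot.mk q) (X_mul_divX_add q)
    rw [AdjoinRoot.mk_self, map_add, map_mul] at h
    have hc : IsUnit (AdjoinRoot.mk q (C (q.coeff 0))) :=
      ((isUnit_iff_ne_zero.2 h0).map C).map _
    refine isUnit_of_mul_isUnit_left (y := AdjoinRoot.mk q q.divX) ?_
    rw [eq_neg_of_add_eq_zero_left h]
    exact hc.neg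
  have hf_unit : IsUnit (AdjoinRoot.mk q f) := by
    have : IsUnit (AdjoinRoot.mk q f ^ 2) := by
      have h : AdjoinRoot.mk q f ^ 2 = AdjoinRoot.mk q X + AdjoinRoot.mk q (f ^ 2 - X) := by
        rw [← map_pow, ← map_add]; congr 1; ring
      rw [h]
      exact hnil.isUnit_add_left_of_commute hroot (Commute.all _ _)
    exact (isUnit_pow_iff two_ne_zero).1 this
  -- Newton lifting of the approximate root `f` of `Y² - X`: the error is nilpotent, and the
  -- derivative `2 f` is a unit because `f²` differs from the unit `X` by a nilpotent.
  obtain ⟨y, ⟨-, hy⟩, -⟩ := existsUnique_nilpotent_sub_and_aeval_eq_zero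
    (R := AdjoinRoot q) (S := AdjoinRoot q) (P := X ^ 2 - C (AdjoinRoot.mk q X))
    (x := AdjoinRoot.mk q f) (by simpa using hnil) (by
      have : IsUnit (2 : AdjoinRoot q) := by
        have h := (isUnit_iff_ne_zero.2 h2).map (algebraMap F (AdjoinRoot q))
        rwa [map_ofNat] at h
      simpa [derivative_X_pow, one_add_one_eq_two] using this.mul hf_unit)
  obtain ⟨p, rfl⟩ := AdjoinRoot.mk_surjective y
  refine ⟨p, ?_⟩
  rw [← AdjoinRoot.mk_eq_zero]
  simpa using hy

/-- Cayley–Hamilton transfers the square root modulo the characteristic polynomial to `A`. Being a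
polynomial in `A`, the root inherits self-adjointness and commutes with whatever commutes with `A`.
-/
theorem exists_sq_aeval_eq {F ι : Type*} [Field F] [IsAlgClosed F] (h2 : (2 : F) ≠ 0)
    [Fintype ι] [DecidableEq ι] (A : Matrix ι ι F) (hA : A.det ≠ 0) :
    ∃ f : F[X], (aeval A f) ^ 2 = A := by
  have h0 : A.charpoly.coeff 0 ≠ 0 := by
    intro h
    rw [det_eq_sign_charpoly_coeff, h, mul_zero] at hA
    exact hA rfl
  obtain ⟨f, q, hf⟩ := exists_dvd_sq_sub_X h2 A.charpoly_monic h0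
  refine ⟨f, ?_⟩
  have := congrArg (aeval A) hf
  rw [map_mul, aeval_self_charpoly, zero_mul, map_sub, map_pow, aeval_X, sub_eq_zero] at this
  exact this

/-! ### Conjugacy in the orthogonal group -/

/-- The adjoint of a matrix with respect to the bilinear form given by `K`. -/
def adj {ℓ : ℕ} (M : Mat ℓ) : Mat ℓ := K ℓ * Mᵀ * K ℓ

theorem adj_mul {ℓ : ℕ} (M N : Mat ℓ) : adj (M * N) = adj N * adj M := by
  unfold adj
  calc K ℓ * (M * N)ᵀ * K ℓ = K ℓ * Nᵀ * 1 * Mᵀ * K ℓ := by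
        rw [Matrix.transpose_mul]; simp only [Matrix.mul_assoc, Matrix.one_mul]
    _ = _ := by rw [← K_mul_K]; simp only [Matrix.mul_assoc]

theorem adj_adj {ℓ : ℕ} (M : Mat ℓ) : adj (adj M) = M := by
  unfold adj
  simp only [Matrix.transpose_mul, Matrix.transpose_transpose, K_transpose]
  calc K ℓ * (K ℓ * (M * K ℓ)) * K ℓ = (K ℓ * K ℓ) * M * (K ℓ * K ℓ) := by
        simp only [Matrix.mul_assoc]
    _ = M := by simp [K_mul_K]

theorem adj_one {ℓ : ℕ} : adj (1 : Mat ℓ) = 1 := by simp [adj, K_mul_K]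

theorem adj_smul {ℓ : ℕ} (z : ℂ) (M : Mat ℓ) : adj (z • M) = z • adj M := by
  simp [adj, Matrix.transpose_smul]

theorem det_adj {ℓ : ℕ} (M : Mat ℓ) : (adj M).det = M.det := by
  have h : (K ℓ).det * (K ℓ).det = 1 := by rw [← Matrix.det_mul, K_mul_K, Matrix.det_one]
  rw [adj, Matrix.det_mul, Matrix.det_mul, Matrix.det_transpose]
  linear_combination M.det * h

theorem adj_aeval_of_adj_eq {ℓ : ℕ} {M : Mat ℓ} (h : adj M = M) (f : ℂ[X]) :
    adj (aeval M f) = aeval M f := by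
  induction f using Polynomial.induction_on' with
  | add p q hp hq =>
    rw [map_add, adj, Matrix.transpose_add, Matrix.mul_add, Matrix.add_mul]
    exact congrArg₂ (· + ·) hp hq
  | monomial k z =>
    have hk : adj (M ^ k) = M ^ k := by
      induction k with
      | zero => simp [adj_one]
      | succ k ih => rw [pow_succ, adj_mul, ih, h, ← pow_succ, pow_succ']
    rw [← C_mul_X_pow_eq_monomial, map_mul, map_pow, aeval_X, aeval_C, Algebra.algebraMap_eq_smul_one,
      smul_mul_assoc, one_mul, adj_smul, hk]

theorem mul_adj_of_mem {ℓ : ℕ} (g : SO ℓ) : ((g : SL ℓ) : Mat ℓ) * adj ((g : SL ℓ) : Mat ℓ) = 1 := by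
  have hg : ((g : SL ℓ) : Mat ℓ) = (K ℓ * (((g : SL ℓ)⁻¹ : SL ℓ) : Mat ℓ) * K ℓ)ᵀ := g.2
  have h : adj ((g : SL ℓ) : Mat ℓ) = (((g : SL ℓ)⁻¹ : SL ℓ) : Mat ℓ) := by
    conv_lhs => rw [hg, adj, Matrix.transpose_transpose]
    calc K ℓ * (K ℓ * (((g : SL ℓ)⁻¹ : SL ℓ) : Mat ℓ) * K ℓ) * K ℓ
        = (K ℓ * K ℓ) * (((g : SL ℓ)⁻¹ : SL ℓ) : Mat ℓ) * (K ℓ * K ℓ) := by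
          simp only [Matrix.mul_assoc]
      _ = _ := by simp [K_mul_K]
  rw [h, ← Matrix.SpecialLinearGroup.coe_mul, mul_inv_cancel, Matrix.SpecialLinearGroup.coe_one]

theorem SO_ext {ℓ : ℕ} {g h : SO ℓ} (H : ((g : SL ℓ) : Mat ℓ) = ((h : SL ℓ) : Mat ℓ)) : g = h :=
  Subtype.ext (Subtype.ext H)

/-- Elements of `SO_{2ℓ+1}(ℂ)` that are conjugate as matrices are conjugate in the group. -/
theorem exists_conj_of_similar {ℓ : ℕ} (g d : SO ℓ) (P : Mat ℓ) (hP : P.det ≠ 0)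
    (hgP : ((g : SL ℓ) : Mat ℓ) * P = P * ((d : SL ℓ) : Mat ℓ)) : ∃ h : SO ℓ, h⁻¹ * g * h = d := by
  set G := ((g : SL ℓ) : Mat ℓ) with hG
  set D := ((d : SL ℓ) : Mat ℓ) with hD
  -- Polar decomposition: `Q` is self-adjoint and commutes with `G`, so its square root `S` does
  -- too, and `S⁻¹ * P` is orthogonal and still intertwines `G` and `D`.
  set Q := P * adj P with hQ
  have hG1 : G * adj G = 1 := mul_adj_of_mem g
  have hG2 : adj G * G = 1 := mul_eq_one_comm.1 hG1
  have hD1 : D * adj D = 1 := mul_adj_of_mem d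
  have hQadj : adj Q = Q := by rw [hQ, adj_mul, adj_adj]
  have hGQ : G * Q = Q * G := by
    have h : G * Q * adj G = Q := by
      calc G * Q * adj G = (G * P) * adj (G * P) := by
            rw [adj_mul, hQ]; simp only [Matrix.mul_assoc]
        _ = P * (D * adj D) * adj P := by rw [hgP, adj_mul]; simp only [Matrix.mul_assoc]
        _ = Q := by rw [hD1, Matrix.mul_one]
    calc G * Q = G * Q * (adj G * G) := by rw [hG2, Matrix.mul_one]
      _ = G * Q * adj G * G := by simp only [Matrix.mul_assoc]
      _ = Q * G := by rw [h]
  have hQdet : Q.det ≠ 0 := by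
    rw [hQ, Matrix.det_mul, det_adj]; exact mul_ne_zero hP hP
  obtain ⟨f, hf⟩ := exists_sq_aeval_eq two_ne_zero Q hQdet
  set S := aeval Q f with hS
  have hSadj : adj S = S := adj_aeval_of_adj_eq hQadj f
  have hSG : G * S = S * G :=
    (Algebra.commute_of_mem_adjoin_singleton_of_commute (R := ℂ) (aeval_mem_adjoin_singleton ℂ Q)
      (show Commute G Q from hGQ)).eq
  have hSdet : IsUnit S.det := by
    refine isUnit_iff_ne_zero.2 fun h => hQdet ?_
    rw [← hf, Matrix.det_pow, h]; simp
  have hSS : S⁻¹ * S = 1 := Matrix.nonsing_inv_mul S hSdet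
  have hSS' : S * S⁻¹ = 1 := Matrix.mul_nonsing_inv S hSdet
  have hSinv : adj S⁻¹ = S⁻¹ := by
    have h : adj S⁻¹ * S = 1 := by rw [← hSadj, ← adj_mul, hSadj, hSS', adj_one]
    calc adj S⁻¹ = adj S⁻¹ * (S * S⁻¹) := by rw [hSS', Matrix.mul_one]
      _ = S⁻¹ := by rw [← Matrix.mul_assoc, h, Matrix.one_mul]
  have hGSinv : G * S⁻¹ = S⁻¹ * G := by
    calc G * S⁻¹ = S⁻¹ * (S * G) * S⁻¹ := by rw [← Matrix.mul_assoc, hSS, Matrix.one_mul]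
      _ = S⁻¹ * G * (S * S⁻¹) := by rw [← hSG]; simp only [Matrix.mul_assoc]
      _ = S⁻¹ * G := by rw [hSS', Matrix.mul_one]
  set N := S⁻¹ * P with hN
  have hNN : N * adj N = 1 := by
    calc N * adj N = S⁻¹ * Q * S⁻¹ := by
          rw [hN, adj_mul, hSinv, hQ]; simp only [Matrix.mul_assoc]
      _ = (S⁻¹ * S) * (S * S⁻¹) := by rw [← hf, pow_two]; simp only [Matrix.mul_assoc]
      _ = 1 := by rw [hSS, hSS', Matrix.mul_one]
  have hGN : G * N = N * D := by
    rw [hN, ← Matrix.mul_assoc, hGSinv, Matrix.mul_assoc, hgP, Matrix.mul_assoc]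
  have hdet : N.det * N.det = 1 := by
    have := congrArg Matrix.det hNN
    rwa [Matrix.det_mul, det_adj, Matrix.det_one] at this
  -- `det N` is `±1`. As the size `2ℓ+1` is odd, scaling by `det N` makes the determinant `1`
  -- without disturbing orthogonality or the intertwining relation.
  have hM1 : (N.det • N).det = 1 := by
    rw [Matrix.det_smul, Fintype.card_fin, pow_succ, pow_mul, pow_two, hdet, one_pow, one_mul, hdet]
  have hM2 : (N.det • N) * adj (N.det • N) = 1 := by
    rw [adj_smul, smul_mul_smul_comm, hNN, hdet, one_smul]
  refine ⟨⟨⟨N.det • N, hM1⟩, mem_SO_of hM1 hM2⟩, ?_⟩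
  rw [mul_assoc, inv_mul_eq_iff_eq_mul]
  apply SO_ext
  change G * (N.det • N) = (N.det • N) * D
  rw [mul_smul_comm, smul_mul_assoc, hGN]

/-! ### Monomial rows -/

/-- Row `i` of `M` has the entry `z` in column `j` and zeroes elsewhere. -/
def RowSingle {ℓ : ℕ} (M : Mat ℓ) (i j : ℕ) (z : ℂ) : Prop :=
  ∀ a b : Fin (2 * ℓ + 1), (a : ℕ) = i → M a b = if (b : ℕ) = j then z else 0

theorem RowSingle.mul {ℓ : ℕ} {M N : Mat ℓ} {i j k : ℕ} {z w : ℂ} (hM : RowSingle M i j z)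
    (hN : RowSingle N j k w) (hj : j < 2 * ℓ + 1) : RowSingle (M * N) i k (z * w) := by
  intro a b ha
  rw [Matrix.mul_apply, Finset.sum_eq_single ⟨j, hj⟩]
  · rw [hM a _ ha, if_pos rfl, hN _ b rfl, mul_ite, mul_zero]
  · intro c _ hc
    rw [hM a c ha, if_neg (fun h => hc (Fin.ext h)), zero_mul]
  · simp

theorem rowSingle_one {ℓ i : ℕ} : RowSingle (1 : Mat ℓ) i i 1 := by
  intro a b ha
  subst ha
  simp only [Matrix.one_apply, Fin.ext_iff, eq_comm]

/-- Elements of the group with a monomial row. -/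
def Moves {ℓ : ℕ} (g : SO ℓ) (i j : ℕ) (z : ℂ) : Prop := RowSingle ((g : SL ℓ) : Mat ℓ) i j z

theorem Moves.mul {ℓ : ℕ} {g h : SO ℓ} {i j k : ℕ} {z w : ℂ} (hg : Moves g i j z)
    (hh : Moves h j k w) (hj : j < 2 * ℓ + 1) : Moves (g * h) i k (z * w) :=
  RowSingle.mul hg hh hj

theorem Moves.mul_one {ℓ : ℕ} {g h : SO ℓ} {i j k : ℕ} (hg : Moves g i j 1)
    (hh : Moves h j k 1) (hj : j < 2 * ℓ + 1) : Moves (g * h) i k 1 := by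
  simpa using hg.mul hh hj

theorem moves_one {ℓ i : ℕ} : Moves (1 : SO ℓ) i i 1 := rowSingle_one

/-- The index `x` (counted from zero) or its mirror image. -/
def pos (ℓ x : ℕ) (b : Bool) : ℕ := if b then x else 2 * ℓ - x

theorem pos_lt {ℓ x : ℕ} (hx : x < ℓ) (b : Bool) : pos ℓ x b < 2 * ℓ + 1 := by
  unfold pos; split_ifs <;> omega

/-! ### Action of the Weyl group representatives on the indices -/

theorem s_moves {ℓ k : ℕ} (h1 : 1 ≤ k) (h2 : k < ℓ) {i j : ℕ}
    (hj : j = if i = k - 1 then k else if i = k then k - 1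
      else if i = 2 * ℓ - k then 2 * ℓ - k + 1
      else if i = 2 * ℓ - k + 1 then 2 * ℓ - k else i) : Moves (s ℓ k) i j 1 := by
  intro a b ha
  have hs : ((s ℓ k : SL ℓ) : Mat ℓ) = sMat ℓ k := by simp only [s, dif_pos (And.intro h1 h2)]
  rw [hs, sMat_eq h1 h2]
  simp only [Equiv.Perm.permMatrix, Equiv.toPEquiv_apply, PEquiv.toMatrix_apply,
    Option.mem_some_iff, Fin.ext_iff, sPerm_val, ha, ← hj]
  simp only [eq_comm]

theorem s_moves_pos {ℓ k x : ℕ} (h1 : 1 ≤ k) (h2 : k < ℓ) (hx : x < ℓ) (b : Bool) :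
    Moves (s ℓ k) (pos ℓ x b)
      (pos ℓ (if x = k - 1 then k else if x = k then k - 1 else x) b) 1 := by
  apply s_moves h1 h2
  cases b
  · simp only [pos]
    split_ifs <;> simp_all <;> omega
  · simp only [pos, if_true]
    split_ifs <;> omega

theorem s_moves_center {ℓ k : ℕ} (h1 : 1 ≤ k) (h2 : k < ℓ) : Moves (s ℓ k) ℓ ℓ 1 := by
  apply s_moves h1 h2
  split_ifs <;> omega

theorem tLast_moves {ℓ : ℕ} (h : 1 ≤ ℓ) {i j : ℕ}
    (hj : j = if i = ℓ - 1 then ℓ + 1 else if i = ℓ + 1 then ℓ - 1 else i) :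
    Moves (tLast ℓ) i j (if i = ℓ then -1 else 1) := by
  intro a b ha
  have hs : ((tLast ℓ : SL ℓ) : Mat ℓ) = tMat ℓ := by simp only [tLast, dif_pos h]
  rw [hs, tMat_eq h]
  simp only [Matrix.diagonal_mul, Equiv.Perm.permMatrix, Equiv.toPEquiv_apply,
    PEquiv.toMatrix_apply, Option.mem_some_iff, Equiv.swap_apply_def, Fin.ext_iff, ha]
  split_ifs at * <;> simp_all

theorem tLast_moves_pos {ℓ x : ℕ} (hx : x < ℓ) (b : Bool) :
    Moves (tLast ℓ) (pos ℓ x b) (pos ℓ x (if x = ℓ - 1 then !b else b)) 1 := by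
  have h := tLast_moves (ℓ := ℓ) (i := pos ℓ x b) (j := pos ℓ x (if x = ℓ - 1 then !b else b))
    (by omega) (by cases b <;> simp only [pos] <;> split_ifs <;> simp_all <;> omega)
  have hc : pos ℓ x b ≠ ℓ := by unfold pos; split_ifs <;> omega
  rwa [if_neg hc] at h

theorem t_self {ℓ : ℕ} : t ℓ ℓ = tLast ℓ := by simp [t]

/-- This recursion drives the downward induction on `k` from `t ℓ ℓ = tLast ℓ`. -/
theorem t_eq_conj {ℓ k : ℕ} (hk : k < ℓ) : t ℓ k = s ℓ k * t ℓ (k + 1) * s ℓ k := by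
  obtain ⟨e, he⟩ : ∃ e, ℓ - k = e + 1 := ⟨ℓ - k - 1, by omega⟩
  have he' : ℓ - (k + 1) = e := by omega
  have hf : (List.range (e + 1)).map (fun j => s ℓ (k + j)) =
      s ℓ k :: (List.range e).map (fun j => s ℓ (k + 1 + j)) := by
    rw [List.range_succ_eq_map, List.map_cons, List.map_map]
    congr 1
    exact List.map_congr_left fun j _ => congrArg (s ℓ) (by simp only [Nat.succ_eq_add_one]; omega)
  simp only [t, he, he', hf, List.prod_cons, List.reverse_cons, List.prod_append, List.prod_nil,
    mul_assoc, _root_.mul_one]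

theorem t_moves_pos {ℓ k x : ℕ} (h1 : 1 ≤ k) (h2 : k ≤ ℓ) (hx : x < ℓ) (b : Bool) :
    Moves (t ℓ k) (pos ℓ x b) (pos ℓ x (if x = k - 1 then !b else b)) 1 := by
  induction h2 using Nat.decreasingInduction generalizing x with
  | self => rw [t_self]; exact tLast_moves_pos hx b
  | of_succ k hk ih =>
    rw [t_eq_conj hk]
    set y := if x = k - 1 then k else if x = k then k - 1 else x with hy
    have hyl : y < ℓ := by rw [hy]; split_ifs <;> omega
    have hyy : (if y = k - 1 then k else if y = k then k - 1 else y) = x := by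
      rw [hy]; split_ifs <;> omega
    have hb : (if y = k + 1 - 1 then !b else b) = (if x = k - 1 then !b else b) := by
      congr 1; rw [hy]; split_ifs <;> simp <;> omega
    have h := ((s_moves_pos h1 hk hx b).mul_one (ih (by omega) hyl) (pos_lt hyl b)).mul_one
      (s_moves_pos h1 hk hyl _) (pos_lt hyl _)
    rwa [hyy, hb] at h

theorem t_moves_center {ℓ k : ℕ} (h1 : 1 ≤ k) (h2 : k ≤ ℓ) : Moves (t ℓ k) ℓ ℓ (-1) := by
  induction h2 using Nat.decreasingInduction with
  | self =>
    rw [t_self]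
    simpa using tLast_moves h1 (i := ℓ) (j := ℓ) (by split_ifs <;> omega)
  | of_succ k hk ih =>
    rw [t_eq_conj hk]
    simpa using ((s_moves_center h1 hk).mul (ih (by omega)) (by omega)).mul
      (s_moves_center h1 hk) (by omega)

/-- Factors act from left to right on row indices: the index `o` is carried upwards by every factor,
and each index it passes drops by one. -/
theorem prod_s_moves_pos {ℓ o e x : ℕ} (he : o + e < ℓ) (hx : x < ℓ) (b : Bool) :
    Moves (((List.range e).map fun j => s ℓ (o + j + 1)).prod) (pos ℓ x b)
      (pos ℓ (if x = o then o + e else if o < x ∧ x ≤ o + e then x - 1 else x) b) 1 := by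
  induction e with
  | zero =>
    have : (if x = o then o + 0 else if o < x ∧ x ≤ o + 0 then x - 1 else x) = x := by
      split_ifs <;> omega
    rw [this]
    exact moves_one
  | succ e ih =>
    rw [List.range_succ, List.map_append, List.prod_append, List.map_singleton,
      List.prod_singleton]
    set y := if x = o then o + e else if o < x ∧ x ≤ o + e then x - 1 else x with hy
    have hyl : y < ℓ := by rw [hy]; split_ifs <;> omega
    have h := (ih (by omega)).mul_one (s_moves_pos (k := o + e + 1) (by omega) (by omega) hyl b)
      (pos_lt hyl b)
    convert h using 2
    rw [hy]; split_ifs <;> omega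

theorem prod_s_moves_center {ℓ o e : ℕ} (he : o + e < ℓ) :
    Moves (((List.range e).map fun j => s ℓ (o + j + 1)).prod) ℓ ℓ 1 := by
  induction e with
  | zero => exact moves_one
  | succ e ih =>
    rw [List.range_succ, List.map_append, List.prod_append, List.map_singleton,
      List.prod_singleton]
    exact (ih (by omega)).mul_one (s_moves_center (by omega) (by omega)) (by omega)

/-- The factor of a part is a negative cycle: the block rotates down by one step, and the
wrap-around from its first to its last index passes to the mirror image, because of `t`. -/
theorem c_moves_pos {ℓ o d x : ℕ} (hd : 1 ≤ d) (h : o + d ≤ ℓ) (hx : x < ℓ) (b : Bool) :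
    Moves (c ℓ o d) (pos ℓ x b)
      (pos ℓ (if x = o then o + d - 1 else if o < x ∧ x < o + d then x - 1 else x)
        (if x = o then !b else b)) 1 := by
  have h1 := prod_s_moves_pos (ℓ := ℓ) (o := o) (e := d - 1) (x := x) (by omega) hx b
  set y := if x = o then o + (d - 1) else if o < x ∧ x ≤ o + (d - 1) then x - 1 else x with hy
  have hyl : y < ℓ := by rw [hy]; split_ifs <;> omega
  have h2 := h1.mul_one (t_moves_pos (k := o + d) (by omega) h hyl b) (pos_lt hyl b)
  have hb : (if y = o + d - 1 then !b else b) = (if x = o then !b else b) := by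
    congr 1; rw [hy]; split_ifs <;> simp <;> omega
  rw [hb] at h2
  have hy' : y = if x = o then o + d - 1 else if o < x ∧ x < o + d then x - 1 else x := by
    rw [hy]; split_ifs <;> omega
  rwa [hy'] at h2

theorem c_moves_center {ℓ o d : ℕ} (hd : 1 ≤ d) (h : o + d ≤ ℓ) : Moves (c ℓ o d) ℓ ℓ (-1) := by
  simpa [c] using (prod_s_moves_center (ℓ := ℓ) (o := o) (e := d - 1) (by omega)).mul
    (t_moves_center (k := o + d) (by omega) h) (by omega)

/-- Each part contributes one `t`, hence one sign at the middle index. This sign is why the parity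
of `μ` matters for the labels. -/
theorem nAux_moves_center {ℓ o : ℕ} {L : List ℕ} (hL : ∀ d ∈ L, 1 ≤ d) (h : o + L.sum ≤ ℓ) :
    Moves (nAux ℓ o L) ℓ ℓ ((-1) ^ L.length) := by
  induction L generalizing o with
  | nil => simpa [nAux] using moves_one (ℓ := ℓ) (i := ℓ)
  | cons d L ih =>
    rw [List.sum_cons] at h
    rw [List.length_cons, pow_succ']
    exact (c_moves_center (hL d (by simp)) (by omega)).mul
      (ih (fun e he => hL e (by simp [he])) (by omega)) (by omega)

theorem nAux_moves_pos_of_lt {ℓ o x : ℕ} {L : List ℕ} (hL : ∀ d ∈ L, 1 ≤ d)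
    (h : o + L.sum ≤ ℓ) (hx : x < o) (b : Bool) :
    Moves (nAux ℓ o L) (pos ℓ x b) (pos ℓ x b) 1 := by
  induction L generalizing o with
  | nil => exact moves_one
  | cons d L ih =>
    rw [List.sum_cons] at h
    have h1 := c_moves_pos (ℓ := ℓ) (o := o) (hL d (by simp)) (by omega) (show x < ℓ by omega) b
    rw [if_neg (by omega), if_neg (by omega), if_neg (by omega)] at h1
    exact h1.mul_one (ih (fun e he => hL e (by simp [he])) (by omega) (by omega))
      (pos_lt (by omega) b)

theorem nAux_moves_pos {ℓ o d x : ℕ} {L₁ L₂ : List ℕ} (hL : ∀ e ∈ L₁ ++ d :: L₂, 1 ≤ e)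
    (h : o + (L₁ ++ d :: L₂).sum ≤ ℓ) (hx : o + L₁.sum ≤ x) (hx' : x < o + L₁.sum + d) (b : Bool) :
    Moves (nAux ℓ o (L₁ ++ d :: L₂)) (pos ℓ x b)
      (pos ℓ (if x = o + L₁.sum then o + L₁.sum + d - 1 else x - 1)
        (if x = o + L₁.sum then !b else b)) 1 := by
  induction L₁ generalizing o with
  | nil =>
    simp only [List.nil_append, List.sum_cons, List.sum_nil, add_zero] at *
    have h1 := c_moves_pos (ℓ := ℓ) (o := o) (hL d (by simp)) (by omega) (show x < ℓ by omega) b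
    have hy : (if x = o then o + d - 1 else if o < x ∧ x < o + d then x - 1 else x) =
        (if x = o then o + d - 1 else x - 1) := by split_ifs <;> omega
    rw [hy] at h1
    have hlt : (if x = o then o + d - 1 else x - 1) < o + d := by split_ifs <;> omega
    exact h1.mul_one (nAux_moves_pos_of_lt (fun e he => hL e (by simp [he])) (by omega) hlt _)
      (pos_lt (by omega) _)
  | cons e L₁ ih =>
    simp only [List.cons_append, List.sum_cons, ← add_assoc] at *
    have he : 1 ≤ e := hL e (by simp)
    have hsum : (L₁ ++ d :: L₂).sum = L₁.sum + (d + L₂.sum) := by simp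
    have h1 := c_moves_pos (ℓ := ℓ) (o := o) he (by omega) (show x < ℓ by omega) b
    rw [if_neg (by omega), if_neg (by omega), if_neg (by omega)] at h1
    exact h1.mul_one (ih (fun a ha => hL a (by simp [List.mem_append] at ha ⊢; tauto)) h hx hx')
      (pos_lt (by omega) b)

/-! ### Diagonalization of `n` -/

/-- The lengths of the cycles of `nAux`: one fixed index in the middle, and a cycle of length `2 d`
for each part `d`. -/
def cycleSize (L : List ℕ) : Option (Fin L.length) → ℕ
  | none => 1
  | some ν => 2 * L[(ν : ℕ)]

/-- The `j`-th index of a cycle of `nAux`. -/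
def cycleIndex (ℓ : ℕ) (L : List ℕ) : (Σ ν, Fin (cycleSize L ν)) → ℕ
  | ⟨none, _⟩ => ℓ
  | ⟨some ν, j⟩ =>
    if (j : ℕ) < L[(ν : ℕ)] then pos ℓ ((L.take ν).sum + j) true
    else pos ℓ ((L.take ν).sum + (j - L[(ν : ℕ)])) false

theorem sum_take_add_le (L : List ℕ) {i k : ℕ} (hi : i < L.length) (hik : i < k) :
    (L.take i).sum + L[i] ≤ (L.take k).sum := by
  rw [← List.sum_take_succ L i hi]
  exact List.Sublist.sum_le_sum (List.take_sublist_take_left hik) (by simp)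

/-- A uniform description of both halves of a cycle: the first `d` places run through the block, the
last `d` through its mirror image. -/
theorem cycleIndex_some {ℓ : ℕ} {L : List ℕ} (ν : Fin L.length) (j : Fin (cycleSize L (some ν))) :
    ∃ x b, cycleIndex ℓ L ⟨some ν, j⟩ = pos ℓ ((L.take ν).sum + x) b ∧ x < L[(ν : ℕ)] ∧
      (j : ℕ) = if b then x else x + L[(ν : ℕ)] := by
  have hj : (j : ℕ) < 2 * L[(ν : ℕ)] := j.2
  by_cases h : (j : ℕ) < L[(ν : ℕ)]
  · exact ⟨j, true, by rw [cycleIndex, if_pos h], h, by simp⟩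
  · exact ⟨j - L[(ν : ℕ)], false, by rw [cycleIndex, if_neg h], by omega, by simp; omega⟩

theorem pos_inj {ℓ x y : ℕ} {b b' : Bool} (hx : x < ℓ) (hy : y < ℓ)
    (h : pos ℓ x b = pos ℓ y b') : x = y ∧ b = b' := by
  cases b <;> cases b' <;> simp [pos] at h <;> simp <;> omega

theorem take_sum_add_lt {ℓ : ℕ} {L : List ℕ} (hL : L.sum = ℓ) (ν : Fin L.length) {x : ℕ}
    (hx : x < L[(ν : ℕ)]) : (L.take ν).sum + x < ℓ := by
  have := sum_take_add_le L ν.2 ν.2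
  rw [List.take_length, hL] at this
  omega

theorem cycleIndex_lt {ℓ : ℕ} {L : List ℕ} (hL : L.sum = ℓ) (u : Σ ν, Fin (cycleSize L ν)) :
    cycleIndex ℓ L u < 2 * ℓ + 1 := by
  obtain ⟨_ | ν, j⟩ := u
  · simp only [cycleIndex]; omega
  · obtain ⟨x, b, h, hx, -⟩ := cycleIndex_some (ℓ := ℓ) ν j
    rw [h]
    exact pos_lt (take_sum_add_lt hL ν hx) b

theorem cycleIndex_injective {ℓ : ℕ} {L : List ℕ} (hL : L.sum = ℓ) :
    Function.Injective (cycleIndex ℓ L) := by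
  have hne : ∀ (ν : Fin L.length) (j : Fin (cycleSize L (some ν))),
      cycleIndex ℓ L ⟨some ν, j⟩ ≠ ℓ := by
    intro ν j h'
    obtain ⟨x, b, h, hx, -⟩ := cycleIndex_some (ℓ := ℓ) ν j
    have := take_sum_add_lt hL ν hx
    rw [h, pos] at h'
    split_ifs at h' <;> omega
  rintro ⟨_ | ν, j⟩ ⟨_ | ν', j'⟩ h
  · have : j = j' := Subsingleton.elim (α := Fin 1) j j'
    rw [this]
  · exact absurd h.symm (hne ν' j')
  · exact absurd h (hne ν j)
  · obtain ⟨x, b, h1, hx, hj⟩ := cycleIndex_some (ℓ := ℓ) ν j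
    obtain ⟨x', b', h1', hx', hj'⟩ := cycleIndex_some (ℓ := ℓ) ν' j'
    rw [h1, h1'] at h
    obtain ⟨h2, rfl⟩ := pos_inj (take_sum_add_lt hL ν hx) (take_sum_add_lt hL ν' hx') h
    have hν : ν = ν' := by
      rcases lt_trichotomy ν ν' with hlt | heq | hlt
      · have := sum_take_add_le L ν.2 (show (ν : ℕ) < ν' from hlt); omega
      · exact heq
      · have := sum_take_add_le L ν'.2 (show (ν' : ℕ) < ν from hlt); omega
    subst hν
    have : x = x' := by omega
    subst this
    rw [Fin.ext (hj.trans hj'.symm)]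

theorem card_cycles (L : List ℕ) :
    Fintype.card (Σ ν, Fin (cycleSize L ν)) = 2 * L.sum + 1 := by
  rw [Fintype.card_sigma, Fintype.sum_option]
  simp only [Fintype.card_fin]
  change 1 + ∑ ν : Fin L.length, 2 * L[(ν : ℕ)] = _
  rw [← Finset.mul_sum, add_comm]
  congr 2
  exact Fin.sum_univ_getElem L

/-- The cycles of `nAux` partition the indices. -/
noncomputable def cycleEquiv {ℓ : ℕ} {L : List ℕ} (hL : L.sum = ℓ) :
    (Σ ν, Fin (cycleSize L ν)) ≃ Fin (2 * ℓ + 1) :=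
  Equiv.ofBijective (fun u => ⟨cycleIndex ℓ L u, cycleIndex_lt hL u⟩) <| by
    rw [Fintype.bijective_iff_injective_and_card]
    refine ⟨fun u v h => cycleIndex_injective hL (Fin.mk.inj h), ?_⟩
    rw [card_cycles, hL, Fintype.card_fin]

theorem cycleEquiv_val {ℓ : ℕ} {L : List ℕ} (hL : L.sum = ℓ) (u : Σ ν, Fin (cycleSize L ν)) :
    (cycleEquiv hL u : ℕ) = cycleIndex ℓ L u := rfl

/-- The predecessor of an element of a cycle. -/
def cyclePred {k : ℕ} (j : Fin k) : Fin k :=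
  ⟨if (j : ℕ) = 0 then k - 1 else j - 1, by have := j.2; split_ifs <;> omega⟩

theorem nAux_moves_cycle {ℓ : ℕ} {L : List ℕ} (hL : L.sum = ℓ) (hpos : ∀ d ∈ L, 1 ≤ d)
    (ν : Fin L.length) (j : Fin (cycleSize L (some ν))) :
    Moves (nAux ℓ 0 L) (cycleIndex ℓ L ⟨some ν, j⟩) (cycleIndex ℓ L ⟨some ν, cyclePred j⟩) 1 := by
  obtain ⟨x, b, h, hx, hj⟩ := cycleIndex_some (ℓ := ℓ) ν j
  obtain ⟨x', b', h', hx', hj'⟩ := cycleIndex_some (ℓ := ℓ) ν (cyclePred j)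
  have hsplit : L = L.take ν ++ L[(ν : ℕ)] :: L.drop (ν + 1) := by
    simp
  have key := nAux_moves_pos (ℓ := ℓ) (o := 0) (L₁ := L.take ν) (d := L[(ν : ℕ)]) (L₂ := L.drop (ν + 1))
    (x := (L.take ν).sum + x) (by rw [← hsplit]; exact hpos) (by rw [← hsplit, hL]; omega)
    (by omega) (by omega) b
  rw [← hsplit] at key
  rw [h, h']
  have hsize : cycleSize L (some ν) = 2 * L[(ν : ℕ)] := rfl
  have hp : (cyclePred j : ℕ) = if (j : ℕ) = 0 then 2 * L[(ν : ℕ)] - 1 else j - 1 := rfl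
  rw [hp] at hj'
  have e1 : (L.take ν).sum + x' = if (L.take ν).sum + x = 0 + (L.take ν).sum then
      0 + (L.take ν).sum + L[(ν : ℕ)] - 1 else (L.take ν).sum + x - 1 := by
    cases b <;> cases b' <;> simp only [if_true, Bool.false_eq_true, if_false] at hj hj' <;>
      split_ifs at hj' ⊢ <;> omega
  have e2 : b' = if (L.take ν).sum + x = 0 + (L.take ν).sum then !b else b := by
    cases b <;> cases b' <;> simp only [if_true, Bool.false_eq_true, if_false] at hj hj' <;>
      split_ifs at hj' ⊢ <;> first | rfl | omega
  rw [e1, e2]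
  exact key

theorem X_pow_sub_one_eq_prod_range {F : Type*} [Field F] {ζ : F} {k : ℕ} (hk : 0 < k)
    (h : IsPrimitiveRoot ζ k) : (X ^ k - 1 : F[X]) = ∏ j ∈ Finset.range k, (X - C (ζ ^ j)) := by
  rw [X_pow_sub_one_eq_prod hk h]
  symm
  refine Finset.prod_bij (fun j _ => ζ ^ j) ?_ ?_ ?_ (fun _ _ => rfl)
  · intro j _
    rw [mem_nthRootsFinset hk, ← pow_mul, mul_comm, pow_mul, h.pow_eq_one, one_pow]
  · intro i hi j hj hij
    exact h.pow_inj (Finset.mem_range.1 hi) (Finset.mem_range.1 hj) hij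
  · intro z hz
    rw [mem_nthRootsFinset hk] at hz
    have : NeZero k := ⟨hk.ne'⟩
    obtain ⟨i, hi, rfl⟩ := h.eq_pow_of_pow_eq_one hz
    exact ⟨i, Finset.mem_range.2 hi, rfl⟩

/-- The eigenvalues of `nAux`. -/
noncomputable def cycleEigenvalue (L : List ℕ) : (Σ ν, Fin (cycleSize L ν)) → ℂ
  | ⟨none, _⟩ => (-1) ^ L.length
  | ⟨some ν, j⟩ => Complex.exp (2 * Real.pi * Complex.I / ((2 * L[(ν : ℕ)] : ℕ) : ℂ)) ^ (j : ℕ)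

theorem prod_cycleEigenvalue (L : List ℕ) (hpos : ∀ d ∈ L, 1 ≤ d) :
    ∏ u, (X - C (cycleEigenvalue L u)) =
      (X - C ((-1) ^ L.length)) * (L.map fun d => (X ^ (2 * d) - 1 : ℂ[X])).prod := by
  rw [Fintype.prod_sigma, Fintype.prod_option]
  congr 1
  · exact Fin.prod_univ_one _
  · rw [← Fin.prod_univ_fun_getElem]
    refine Finset.prod_congr rfl fun ν _ => ?_
    have hd : 0 < 2 * L[(ν : ℕ)] := by have := hpos L[(ν : ℕ)] (List.getElem_mem _); omega
    refine Eq.trans ?_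
      (X_pow_sub_one_eq_prod_range hd (Complex.isPrimitiveRoot_exp _ hd.ne')).symm
    exact Fin.prod_univ_eq_prod_range
      (fun j => X - C (Complex.exp (2 * Real.pi * Complex.I / ((2 * L[(ν : ℕ)] : ℕ) : ℂ)) ^ j)) _

/-- The eigenvectors of `nAux`, cycle by cycle. -/
noncomputable def cycleVectors (L : List ℕ) (ν : Option (Fin L.length)) :
    Matrix (Fin (cycleSize L ν)) (Fin (cycleSize L ν)) ℂ :=
  Matrix.of fun j a => (cycleEigenvalue L ⟨ν, a⟩)⁻¹ ^ (j : ℕ)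

/-- Up to transposition this is a Vandermonde matrix, whose nodes are distinct because the powers of
a primitive root are. -/
theorem isUnit_det_cycleVectors (L : List ℕ) (hpos : ∀ d ∈ L, 1 ≤ d) (ν : Option (Fin L.length)) :
    IsUnit (cycleVectors L ν).det := by
  have hV : cycleVectors L ν = (Matrix.vandermonde fun a => (cycleEigenvalue L ⟨ν, a⟩)⁻¹)ᵀ := by
    ext j a; simp [cycleVectors, Matrix.vandermonde_apply]
  rw [hV, Matrix.det_transpose, isUnit_iff_ne_zero, Matrix.det_vandermonde_ne_zero_iff]
  intro a a' h
  replace h := inv_injective h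
  cases ν with
  | none => exact Subsingleton.elim (α := Fin 1) a a'
  | some ν =>
    have hd : 0 < 2 * L[(ν : ℕ)] := by have := hpos L[(ν : ℕ)] (List.getElem_mem _); omega
    exact Fin.ext ((Complex.isPrimitiveRoot_exp _ hd.ne').pow_inj a.2 a'.2 h)

theorem cycleEigenvalue_ne_zero (L : List ℕ) (u : Σ ν, Fin (cycleSize L ν)) :
    cycleEigenvalue L u ≠ 0 := by
  obtain ⟨_ | ν, j⟩ := u
  · simp [cycleEigenvalue]
  · simp [cycleEigenvalue, Complex.exp_ne_zero]

/-- This is the eigenvector equation, since each row of a cycle picks out the preceding entry; at `j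
= 0` it uses that the eigenvalue is a `2 d`-th root of unity. -/
theorem cycleVectors_pred (L : List ℕ) (hpos : ∀ d ∈ L, 1 ≤ d) (ν : Fin L.length)
    (j a : Fin (cycleSize L (some ν))) :
    cycleVectors L (some ν) (cyclePred j) a =
      cycleVectors L (some ν) j a * cycleEigenvalue L ⟨some ν, a⟩ := by
  have hd : 0 < 2 * L[(ν : ℕ)] := by have := hpos L[(ν : ℕ)] (List.getElem_mem _); omega
  have h0 := cycleEigenvalue_ne_zero L ⟨some ν, a⟩
  have h1 : cycleEigenvalue L ⟨some ν, a⟩ ^ (2 * L[(ν : ℕ)]) = 1 := by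
    simp only [cycleEigenvalue]
    rw [pow_right_comm, (Complex.isPrimitiveRoot_exp _ hd.ne').pow_eq_one, one_pow]
  have hp : (cyclePred j : ℕ) = if (j : ℕ) = 0 then 2 * L[(ν : ℕ)] - 1 else j - 1 := rfl
  simp only [cycleVectors, Matrix.of_apply, hp]
  set w := cycleEigenvalue L ⟨some ν, a⟩
  split_ifs with hj
  · obtain ⟨e, he⟩ : ∃ e, 2 * L[(ν : ℕ)] = e + 1 := ⟨2 * L[(ν : ℕ)] - 1, by omega⟩
    rw [he] at h1 ⊢
    rw [hj, pow_zero, one_mul, Nat.add_sub_cancel, inv_pow]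
    rw [pow_succ] at h1
    exact inv_eq_of_mul_eq_one_right h1
  · obtain ⟨e, he⟩ : ∃ e, (j : ℕ) = e + 1 := ⟨j - 1, by omega⟩
    rw [he, Nat.add_sub_cancel, pow_succ, mul_assoc, inv_mul_cancel₀ h0, mul_one]

theorem nAux_diagonalizable {ℓ : ℕ} {L : List ℕ} (hL : L.sum = ℓ) (hpos : ∀ d ∈ L, 1 ≤ d) :
    ∃ (P : Mat ℓ) (w : Fin (2 * ℓ + 1) → ℂ), P.det ≠ 0 ∧
      ((nAux ℓ 0 L : SL ℓ) : Mat ℓ) * P = P * Matrix.diagonal w ∧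
      ∏ i, (X - C (w i)) =
        (X - C ((-1) ^ L.length)) * (L.map fun d => (X ^ (2 * d) - 1 : ℂ[X])).prod := by
  set e := cycleEquiv hL with he
  set V := Matrix.blockDiagonal' (cycleVectors L) with hV
  refine ⟨V.submatrix e.symm e.symm, cycleEigenvalue L ∘ e.symm, ?_, ?_, ?_⟩
  · rw [Matrix.det_submatrix_equiv_self, ← isUnit_iff_ne_zero, ← Matrix.isUnit_iff_isUnit_det]
    refine IsUnit.of_mul_eq_one (Matrix.blockDiagonal' fun ν => (cycleVectors L ν)⁻¹) ?_
    rw [hV, ← Matrix.blockDiagonal'_mul]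
    have : (fun ν => cycleVectors L ν * (cycleVectors L ν)⁻¹) = fun _ => 1 :=
      funext fun ν => Matrix.mul_nonsing_inv _ (isUnit_det_cycleVectors L hpos ν)
    rw [this]
    exact Matrix.blockDiagonal'_one
  · ext i k
    obtain ⟨u, rfl⟩ := e.surjective i
    obtain ⟨v, rfl⟩ := e.surjective k
    rw [Matrix.mul_diagonal]
    -- A monomial row reduces the matrix product to one entry of `V`.
    have row : ∀ u' z, Moves (nAux ℓ 0 L) (cycleIndex ℓ L u) (cycleIndex ℓ L u') z →
        (((nAux ℓ 0 L : SL ℓ) : Mat ℓ) * V.submatrix e.symm e.symm) (e u) (e v) = z * V u' v := by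
      intro u' z hm
      rw [Matrix.mul_apply, Finset.sum_eq_single (e u')]
      · rw [hm (e u) (e u') rfl, if_pos (cycleEquiv_val hL u')]
        simp
      · intro a _ ha
        rw [hm (e u) a rfl, if_neg fun h => ha (Fin.ext (h.trans (cycleEquiv_val hL u').symm)),
          zero_mul]
      · simp
    simp only [Matrix.submatrix_apply, Equiv.symm_apply_apply, Function.comp_apply]
    obtain ⟨_ | ν, j⟩ := u
    · rw [row ⟨none, j⟩ _ (nAux_moves_center hpos (by omega))]
      obtain ⟨_ | ν', a⟩ := v
      · exact mul_comm _ _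
      · simp [hV, Matrix.blockDiagonal'_apply]
    · rw [row ⟨some ν, cyclePred j⟩ _ (nAux_moves_cycle hL hpos ν j), one_mul]
      obtain ⟨ν', a⟩ := v
      by_cases hν : some ν = ν'
      · subst hν
        rw [hV, Matrix.blockDiagonal'_apply_eq, Matrix.blockDiagonal'_apply_eq,
          cycleVectors_pred L hpos]
      · rw [hV, Matrix.blockDiagonal'_apply_ne _ _ _ hν, Matrix.blockDiagonal'_apply_ne _ _ _ hν,
          zero_mul]
  · rw [← prod_cycleEigenvalue L hpos, ← e.symm.prod_comp]
    rfl

/-! ### The numbers attached to a partition -/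

theorem m_pos {ℓ : ℕ} (p : ℓ.Partition) : 0 < m p := by
  have : p.parts.lcm ≠ 0 := by
    rw [Ne, Multiset.lcm_eq_zero_iff]
    exact fun h => absurd (p.parts_pos h) (lt_irrefl 0)
  unfold m; omega

theorem two_mul_dvd_m {ℓ : ℕ} (p : ℓ.Partition) {d : ℕ} (hd : d ∈ p.parts) : 2 * d ∣ m p :=
  mul_dvd_mul_left 2 (Multiset.dvd_lcm hd)

theorem m_dvd {ℓ : ℕ} (p : ℓ.Partition) {k : ℕ} (h2 : 2 ∣ k) (h : ∀ d ∈ p.parts, 2 * d ∣ k) :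
    m p ∣ k := by
  obtain ⟨j, rfl⟩ := h2
  exact mul_dvd_mul_left 2 (Multiset.lcm_dvd.2 fun d hd =>
    Nat.dvd_of_mul_dvd_mul_left two_pos (h d hd))

theorem two_mul_half_m {ℓ : ℕ} (p : ℓ.Partition) : 2 * (m p / 2) = m p := by
  unfold m; omega

theorem card_parts_pos {ℓ : ℕ} (hℓ : 0 < ℓ) (p : ℓ.Partition) : 0 < p.parts.card := by
  rw [Multiset.card_pos]
  intro h
  have := p.parts_sum
  rw [h, Multiset.sum_zero] at this
  omega

theorem sum_map_sub_one_add_card (S : Multiset ℕ) (h : ∀ d ∈ S, 0 < d) :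
    (S.map fun d => d - 1).sum + S.card = S.sum := by
  induction S using Multiset.induction_on with
  | empty => simp
  | cons d S ih =>
    have h1 := ih fun e he => h e (Multiset.mem_cons_of_mem he)
    have h2 := h d (Multiset.mem_cons_self d S)
    simp only [Multiset.map_cons, Multiset.sum_cons, Multiset.card_cons]
    omega

theorem card_sigmaMultiset {ℓ : ℕ} (p : ℓ.Partition) : (sigmaMultiset p).card = ℓ := by
  have h := sum_map_sub_one_add_card p.parts (fun d hd => p.parts_pos hd)
  rw [p.parts_sum] at h
  simp only [sigmaMultiset, Multiset.card_add, Multiset.card_replicate, Multiset.card_bind,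
    Function.comp_def, Multiset.card_map, Finset.card_val, Nat.card_Icc, Nat.add_sub_cancel]
  omega

theorem two_mul_le_of_mem_sigmaMultiset {ℓ : ℕ} {p : ℓ.Partition} {x : ℕ}
    (hx : x ∈ sigmaMultiset p) : 2 * x ≤ m p := by
  simp only [sigmaMultiset, Multiset.mem_add, Multiset.mem_bind, Multiset.mem_map,
    Finset.mem_val, Finset.mem_Icc, Multiset.mem_replicate] at hx
  rcases hx with (⟨d, hd, a, ⟨ha1, ha2⟩, rfl⟩ | ⟨-, rfl⟩) | ⟨-, rfl⟩
  · obtain ⟨q, hq⟩ := two_mul_dvd_m p hd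
    have hd0 := p.parts_pos hd
    rw [hq, mul_left_comm, Nat.mul_div_cancel_left _ (by omega), mul_assoc]
    exact Nat.mul_le_mul_left 2 (Nat.mul_le_mul_right q (by omega))
  · exact (two_mul_half_m p).le
  · simp

theorem half_m_mem_sigmaMultiset {ℓ : ℕ} (hℓ : 0 < ℓ) (p : ℓ.Partition) :
    m p / 2 ∈ sigmaMultiset p := by
  have := card_parts_pos hℓ p
  simp only [sigmaMultiset, Multiset.mem_add, Multiset.mem_replicate]
  exact Or.inl (Or.inr ⟨by omega, trivial⟩)

/-- The coordinates `(σ₁, …, σ_ℓ)`. -/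
def sigmaVec {ℓ : ℕ} (p : ℓ.Partition) (i : Fin ℓ) : ℤ := sigma p (i + 1)

theorem sigmaVec_eq {ℓ : ℕ} (p : ℓ.Partition) (i : Fin ℓ)
    (hi : (i : ℕ) < ((sigmaMultiset p).sort (· ≥ ·)).length) :
    sigmaVec p i = (((sigmaMultiset p).sort (· ≥ ·))[(i : ℕ)] : ℕ) := by
  rw [sigmaVec, sigma, Nat.add_sub_cancel, List.getD_eq_getElem _ _ hi]

theorem length_sort_sigmaMultiset {ℓ : ℕ} (p : ℓ.Partition) :
    ((sigmaMultiset p).sort (· ≥ ·)).length = ℓ := by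
  rw [Multiset.length_sort, card_sigmaMultiset]

theorem map_sigmaVec {ℓ : ℕ} (p : ℓ.Partition) :
    Finset.univ.val.map (sigmaVec p) = (sigmaMultiset p).map (fun x : ℕ => (x : ℤ)) := by
  have h := length_sort_sigmaMultiset p
  have h1 : (List.ofFn (sigmaVec p)) =
      ((sigmaMultiset p).sort (· ≥ ·)).map (fun x : ℕ => (x : ℤ)) := by
    apply List.ext_getElem
    · simp [h]
    · intro i h1 h2
      rw [List.length_ofFn] at h1
      rw [List.getElem_ofFn, List.getElem_map]
      exact sigmaVec_eq p ⟨i, h1⟩ (by rw [h]; exact h1)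
  rw [Fin.univ_val_map, h1, ← Multiset.map_coe, Multiset.sort_eq]

theorem sigmaVec_antitone {ℓ : ℕ} (p : ℓ.Partition) : Antitone (sigmaVec p) := by
  have h := length_sort_sigmaMultiset p
  intro i j hij
  rw [sigmaVec_eq p i (by rw [h]; exact i.2), sigmaVec_eq p j (by rw [h]; exact j.2), Nat.cast_le]
  rcases hij.eq_or_lt with rfl | hlt
  · rfl
  · exact List.pairwise_iff_getElem.1 (Multiset.pairwise_sort (sigmaMultiset p) (· ≥ ·)) i j
      (by rw [h]; exact i.2) (by rw [h]; exact j.2) hlt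

theorem exists_of_mem_sigmaMultiset {ℓ : ℕ} {p : ℓ.Partition} {x : ℕ} (hx : x ∈ sigmaMultiset p) :
    ∃ i, sigmaVec p i = x := by
  have : (x : ℤ) ∈ Finset.univ.val.map (sigmaVec p) := by
    rw [map_sigmaVec]; exact Multiset.mem_map_of_mem _ hx
  simpa using this

theorem sigmaVec_mem {ℓ : ℕ} (p : ℓ.Partition) (i : Fin ℓ) :
    ∃ x ∈ sigmaMultiset p, sigmaVec p i = x := by
  have : sigmaVec p i ∈ (sigmaMultiset p).map (fun x : ℕ => (x : ℤ)) := by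
    rw [← map_sigmaVec]; exact Multiset.mem_map_of_mem _ (Finset.mem_univ i)
  obtain ⟨x, hx, h⟩ := Multiset.mem_map.1 this
  exact ⟨x, hx, h.symm⟩

theorem sigmaVec_nonneg {ℓ : ℕ} (p : ℓ.Partition) (i : Fin ℓ) : 0 ≤ sigmaVec p i := by
  obtain ⟨x, -, h⟩ := sigmaVec_mem p i
  omega

theorem two_mul_sigmaVec_le {ℓ : ℕ} (p : ℓ.Partition) (i : Fin ℓ) : 2 * sigmaVec p i ≤ m p := by
  obtain ⟨x, hx, h⟩ := sigmaVec_mem p i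
  have := two_mul_le_of_mem_sigmaMultiset hx
  omega

/-! ### The characteristic polynomial of `n` -/

theorem prod_range_mirror {M : Type*} [CommMonoid M] (f : ℕ → M) (k : ℕ) :
    ∏ i ∈ Finset.range (2 * k + 1), f i =
      f k * ∏ i ∈ Finset.range k, (f i * f (2 * k - i)) := by
  rw [Finset.prod_mul_distrib, show 2 * k + 1 = k + 1 + k by omega, Finset.prod_range_add,
    Finset.prod_range_succ, ← Finset.prod_range_reflect (fun i => f (k + 1 + i)) k,
    mul_comm _ (f k), mul_assoc]
  congr 2
  refine Finset.prod_congr rfl fun i hi => congrArg f ?_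
  have := Finset.mem_range.1 hi
  omega

theorem prod_expo {ℓ : ℕ} {M : Type*} [CommMonoid M] (a : Fin ℓ → ℤ) (f : ℤ → M) :
    ∏ i, f (expo a i) = f 0 * ∏ i, (f (a i) * f (-a i)) := by
  have h := prod_range_mirror
    (fun i => if h : i < 2 * ℓ + 1 then f (expo a ⟨i, h⟩) else 1) ℓ
  rw [Finset.prod_range, Finset.prod_range] at h
  simp only [Fin.is_lt, dif_pos, Fin.eta] at h
  rw [h, dif_pos (by omega)]
  congr 1
  · simp [expo]
  · refine Finset.prod_congr rfl fun i _ => ?_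
    have hi := i.2
    rw [dif_pos (by omega), dif_pos (by omega)]
    have h1 : expo a ⟨i, by omega⟩ = a i := by simp [expo]
    have h2 : (⟨2 * ℓ - i, by omega⟩ : Fin (2 * ℓ + 1)) = Fin.rev ⟨i, by omega⟩ := by
      ext; simp [Fin.val_rev]
    rw [h2, expo_rev, h1]

/-- The quadratic polynomial with the roots `ξ^s` and `ξ^{-s}`. -/
noncomputable def quad (ξ : ℂˣ) (s : ℤ) : ℂ[X] :=
  (X - C ((ξ ^ s : ℂˣ) : ℂ)) * (X - C ((ξ ^ (-s) : ℂˣ) : ℂ))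

/-- With `ζ = ξ^(N/(2 d))`, the `2 d`-th roots of unity are `1`, `-1 = ζ^d` and the inverse pairs
`ζ^a`, `ζ^(-a)` for `1 ≤ a ≤ d - 1`. -/
theorem prod_quad_of_dvd {ξ : ℂˣ} {N d : ℕ} (hN : 0 < N) (hξ : IsPrimitiveRoot ξ N) (hd : 0 < d)
    (hdN : 2 * d ∣ N) :
    (X - 1) * (X + 1) * ((Finset.Icc 1 (d - 1)).val.map
      fun a => quad ξ ((a * N / (2 * d) : ℕ) : ℤ)).prod = X ^ (2 * d) - 1 := by
  obtain ⟨q, hq⟩ := hdN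
  have hw : IsPrimitiveRoot (ξ ^ q) (2 * d) := hξ.pow hN (by rw [hq, mul_comm])
  have hw' : IsPrimitiveRoot ((ξ ^ q : ℂˣ) : ℂ) (2 * d) := IsPrimitiveRoot.coe_units_iff.2 hw
  obtain ⟨e, rfl⟩ : ∃ e, d = e + 1 := ⟨d - 1, by omega⟩
  have hhalf : ((ξ ^ q : ℂˣ) : ℂ) ^ (e + 1) = -1 := by
    have h2 : IsPrimitiveRoot (((ξ ^ q : ℂˣ) : ℂ) ^ (e + 1)) 2 :=
      hw'.pow (by omega) (by rw [mul_comm])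
    exact h2.eq_neg_one_of_two_right
  have hprod : ((Finset.Icc 1 (e + 1 - 1)).val.map
      fun a => quad ξ ((a * N / (2 * (e + 1)) : ℕ) : ℤ)).prod =
      ∏ i ∈ Finset.range e, ((X - C (((ξ ^ q : ℂˣ) : ℂ) ^ (i + 1))) *
        (X - C (((ξ ^ q : ℂˣ) : ℂ) ^ (2 * e - i + 1)))) := by
    change ∏ a ∈ Finset.Icc 1 (e + 1 - 1), quad ξ ((a * N / (2 * (e + 1)) : ℕ) : ℤ) = _
    rw [show Finset.Icc 1 (e + 1 - 1) = Finset.Ico 1 (e + 1) by ext; simp,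
      Finset.prod_Ico_eq_prod_range]
    refine Finset.prod_congr rfl fun i hi => ?_
    have hi' := Finset.mem_range.1 hi
    have hdiv : (1 + i) * N / (2 * (e + 1)) = q * (i + 1) := by
      rw [hq, mul_left_comm, Nat.mul_div_cancel_left _ (by omega)]; ring
    have hinv : ξ ^ (-((q * (i + 1) : ℕ) : ℤ)) = (ξ ^ q) ^ (2 * e - i + 1) := by
      rw [_root_.zpow_neg, zpow_natCast, inv_eq_iff_mul_eq_one, ← pow_mul, ← pow_add, ← mul_add,
        show i + 1 + (2 * e - i + 1) = 2 * (e + 1) by omega, pow_mul, hw.pow_eq_one]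
    rw [quad, hdiv, hinv, zpow_natCast, pow_mul]
    simp only [Units.val_pow_eq_pow_val]
  rw [hprod]
  rw [X_pow_sub_one_eq_prod_range (by omega) hw', show Finset.range (2 * (e + 1)) = Finset.range (2 * e + 1 + 1) from rfl,
    Finset.prod_range_succ', prod_range_mirror, hhalf, pow_zero]
  simp only [map_one, map_neg]
  ring

theorem prod_expo_sigmaVec {ℓ : ℕ} (p : ℓ.Partition) {ξ : ℂˣ} (hξ : IsPrimitiveRoot ξ (m p)) :
    ∏ i, (X - C ((ξ ^ expo (sigmaVec p) i : ℂˣ) : ℂ)) =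
      (X - C ((-1) ^ p.parts.card)) * (p.parts.map fun d => (X ^ (2 * d) - 1 : ℂ[X])).prod := by
  have h0 : quad ξ 0 = (X - 1) ^ 2 := by simp [quad]; ring
  have hhalf : ((ξ ^ ((m p / 2 : ℕ) : ℤ) : ℂˣ) : ℂ) = -1 := by
    have h : IsPrimitiveRoot ((ξ : ℂ) ^ (m p / 2)) 2 :=
      (IsPrimitiveRoot.coe_units_iff.2 hξ).pow (m_pos p) (by rw [mul_comm, two_mul_half_m])
    rw [zpow_natCast, Units.val_pow_eq_pow_val]
    exact h.eq_neg_one_of_two_right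
  have h1 : quad ξ ((m p / 2 : ℕ) : ℤ) = (X + 1) ^ 2 := by
    have hinv : ((ξ ^ (-((m p / 2 : ℕ) : ℤ)) : ℂˣ) : ℂ) = -1 := by
      rw [_root_.zpow_neg, Units.val_inv_eq_inv_val, hhalf]; norm_num
    rw [quad, hhalf, hinv]
    simp only [map_one, map_neg]
    ring
  rw [prod_expo (sigmaVec p) fun s => X - C ((ξ ^ s : ℂˣ) : ℂ)]
  have h2 : ∏ i, ((X - C ((ξ ^ sigmaVec p i : ℂˣ) : ℂ)) *
      (X - C ((ξ ^ (-sigmaVec p i) : ℂˣ) : ℂ))) =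
      ((sigmaMultiset p).map fun x : ℕ => quad ξ x).prod := by
    have := congrArg (fun S => (Multiset.map (quad ξ) S).prod) (map_sigmaVec p)
    rw [Multiset.map_map, Multiset.map_map] at this
    exact this
  have h3 : (p.parts.map fun d => (X ^ (2 * d) - 1 : ℂ[X])).prod =
      ((X - 1) * (X + 1)) ^ p.parts.card * (p.parts.map fun d => ((Finset.Icc 1 (d - 1)).val.map
        fun a => quad ξ ((a * m p / (2 * d) : ℕ) : ℤ)).prod).prod := by
    rw [← Multiset.prod_replicate, ← Multiset.map_const', ← Multiset.prod_map_mul]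
    refine congrArg _ (Multiset.map_congr rfl fun d hd => ?_)
    exact (prod_quad_of_dvd (m_pos p) hξ (p.parts_pos hd) (two_mul_dvd_m p hd)).symm
  rw [h2, h3, sigmaMultiset, Multiset.map_add, Multiset.map_add, Multiset.prod_add,
    Multiset.prod_add, Multiset.map_bind, Multiset.prod_bind, Multiset.map_replicate,
    Multiset.map_replicate, Multiset.prod_replicate, Multiset.prod_replicate, h1, Nat.cast_zero, h0]
  simp only [Multiset.map_map, Function.comp_def]
  -- The claim left is `(X-1)(X+1)^(2⌈μ/2⌉)(X-1)^(2⌊μ/2⌋) = (X-(-1)^μ)(X²-1)^μ`. For odd `μ` the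
  -- middle eigenvalue `-1` trades places with a `1`, which accounts for the ceiling and the floor.
  rcases Nat.even_or_odd' p.parts.card with ⟨k, hk | hk⟩
  · rw [hk, show (2 * k + 1) / 2 = k by omega, show 2 * k / 2 = k by omega]
    simp only [zpow_zero, Units.val_one, map_one, pow_mul, neg_sq, one_pow]
    rw [mul_pow, mul_pow]
    ring
  · rw [hk, show (2 * k + 1 + 1) / 2 = k + 1 by omega, show (2 * k + 1) / 2 = k by omega]
    simp only [zpow_zero, Units.val_one, map_one, pow_mul, pow_succ (-1 : ℂ) (2 * k), neg_sq,
      one_pow, one_mul, map_neg, sub_neg_eq_add]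
    generalize (X - 1 : ℂ[X]) = u, (X + 1 : ℂ[X]) = v, Multiset.prod (M := ℂ[X]) _ = Z
    ring

/-! ### The element `n` is conjugate to an element of the torus -/

theorem exists_equiv_of_map_eq {ι κ α : Type*} [Fintype ι] [Fintype κ] {f : ι → α} {g : κ → α}
    (h : Finset.univ.val.map f = Finset.univ.val.map g) : ∃ e : ι ≃ κ, g ∘ e = f := by
  classical
  have hcard : ∀ z, Nonempty ({i // f i = z} ≃ {k // g k = z}) := by
    intro z
    rw [← Fintype.card_eq, Fintype.card_subtype, Fintype.card_subtype]
    have := congrArg (Multiset.count z) h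
    rw [Multiset.count_map, Multiset.count_map] at this
    simpa [Finset.card_def, Finset.filter_val, eq_comm] using this
  exact ⟨Equiv.ofFiberEquiv fun z => (hcard z).some, funext fun i => Equiv.ofFiberEquiv_map _ i⟩

theorem map_eq_of_prod_X_sub_C_eq {ι κ F : Type*} [Fintype ι] [Fintype κ] [Field F] {f : ι → F}
    {g : κ → F} (h : ∏ i, (X - C (f i)) = ∏ k, (X - C (g k))) :
    Finset.univ.val.map f = Finset.univ.val.map g := by
  have h' : ((Finset.univ.val.map f).map fun z => X - C z).prod =
      ((Finset.univ.val.map g).map fun z => X - C z).prod := by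
    rw [Multiset.map_map, Multiset.map_map]
    exact h
  rw [← roots_multiset_prod_X_sub_C (Finset.univ.val.map f), h', roots_multiset_prod_X_sub_C]

theorem coe_coch {ℓ : ℕ} (a : Fin ℓ → ℤ) (z : ℂˣ) : ((coch a z : SL ℓ) : Mat ℓ) =
    Matrix.diagonal fun i => ((z ^ expo a i : ℂˣ) : ℂ) := rfl

theorem exists_conj_n_eq_coch {ℓ : ℕ} (p : ℓ.Partition) {ξ : ℂˣ} (hξ : IsPrimitiveRoot ξ (m p)) :
    ∃ h : SO ℓ, h⁻¹ * n p * h = coch (sigmaVec p) ξ := by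
  set L := p.parts.sort (· ≤ ·) with hL
  have hLp : (L : Multiset ℕ) = p.parts := Multiset.sort_eq _ _
  obtain ⟨P, w, hP, hnP, hw⟩ := nAux_diagonalizable (ℓ := ℓ) (L := L)
    (by rw [← Multiset.sum_coe, hLp, p.parts_sum])
    (fun d hd => p.parts_pos (by rwa [← hLp, Multiset.mem_coe]))
  rw [← Multiset.coe_card, ← Multiset.prod_coe, ← Multiset.map_coe, hLp,
    ← prod_expo_sigmaVec p hξ] at hw
  obtain ⟨e, he⟩ := exists_equiv_of_map_eq (map_eq_of_prod_X_sub_C_eq hw.symm)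
  refine exists_conj_of_similar _ _ (P.submatrix id e) ?_ ?_
  · rw [Matrix.det_permute']
    exact mul_ne_zero (by simp) hP
  · rw [coe_coch]
    ext i j
    have h := congrFun (congrFun hnP i) (e j)
    rw [Matrix.mul_diagonal] at h ⊢
    rw [← congrFun he j]
    exact h

/-! ### The order of `n` -/

theorem orderOf_coch_sigmaVec {ℓ : ℕ} (hℓ : 0 < ℓ) (p : ℓ.Partition) {ξ : ℂˣ}
    (hξ : IsPrimitiveRoot ξ (m p)) : orderOf (coch (sigmaVec p) ξ) = m p := by
  apply Nat.dvd_antisymm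
  · rw [orderOf_dvd_iff_pow_eq_one, ← map_pow, hξ.pow_eq_one, map_one]
  set k := orderOf (coch (sigmaVec p) ξ) with hk
  have hone : coch (sigmaVec p) (ξ ^ k) = 1 := by rw [map_pow, hk, pow_orderOf_eq_one]
  have hdvd : ∀ x ∈ sigmaMultiset p, m p ∣ k * x := by
    intro x hx
    obtain ⟨i, hi⟩ := exists_of_mem_sigmaMultiset hx
    have h1 := congrArg (fun g : SO ℓ => ((g : SL ℓ) : Mat ℓ) ⟨i, by omega⟩ ⟨i, by omega⟩) hone
    have h2 : expo (sigmaVec p) ⟨i, by omega⟩ = x := by simp [expo, hi]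
    simp only [coe_coch, Matrix.diagonal_apply_eq, h2, zpow_natCast, OneMemClass.coe_one,
      Matrix.SpecialLinearGroup.coe_one, Matrix.one_apply_eq, ← pow_mul] at h1
    exact hξ.dvd_of_pow_eq_one _ (Units.ext h1)
  -- The entry `m/2` forces `k` to be even; a part `d > 1` forces `2 d ∣ k` through its entry `m/(2
  -- d)`. Parts equal to `1` have no such entry and rely on evenness alone.
  have h2 : 2 ∣ k := by
    have h := hdvd _ (half_m_mem_sigmaMultiset hℓ p)
    have h0 := two_mul_half_m p
    have hp := m_pos p
    refine Nat.dvd_of_mul_dvd_mul_right (show 0 < m p / 2 by omega) ?_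
    rwa [h0]
  refine m_dvd p h2 fun d hd => ?_
  have hd0 := p.parts_pos hd
  rcases Nat.lt_or_ge 1 d with hd1 | hd1
  · obtain ⟨q, hq⟩ := two_mul_dvd_m p hd
    have hmem : q ∈ sigmaMultiset p := by
      simp only [sigmaMultiset, Multiset.mem_add, Multiset.mem_bind, Multiset.mem_map,
        Finset.mem_val, Finset.mem_Icc]
      refine Or.inl (Or.inl ⟨d, hd, 1, ⟨le_rfl, by omega⟩, ?_⟩)
      rw [hq, one_mul, Nat.mul_div_cancel_left _ (by omega)]
    have h := hdvd q hmem
    have hq0 : 0 < q := Nat.pos_of_ne_zero fun h0 => by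
      have := m_pos p
      rw [hq, h0, mul_zero] at this
      exact lt_irrefl 0 this
    rw [hq] at h
    exact Nat.dvd_of_mul_dvd_mul_right hq0 h
  · obtain rfl : d = 1 := by omega
    exact h2

theorem orderOf_n {ℓ : ℕ} (hℓ : 0 < ℓ) (p : ℓ.Partition) {ξ : ℂˣ}
    (hξ : IsPrimitiveRoot ξ (m p)) : orderOf (n p) = m p := by
  obtain ⟨h, hh⟩ := exists_conj_n_eq_coch p hξ
  rw [← orderOf_coch_sigmaVec hℓ p hξ, ← hh]
  have := MulAut.conj h⁻¹ |>.orderOf_eq (n p)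
  rw [← this, MulAut.conj_apply, inv_inv]

/-! ### Coordinates on the alcove -/

/-- The extension of a vector by zero. -/
def ext0 {ℓ : ℕ} {R : Type*} [Zero R] (x : Fin ℓ → R) (i : ℕ) : R :=
  if h : i < ℓ then x ⟨i, h⟩ else 0

theorem ext0_val {ℓ : ℕ} {R : Type*} [Zero R] (x : Fin ℓ → R) (i : Fin ℓ) :
    ext0 x i = x i := by simp [ext0]

theorem ext0_of_le {ℓ : ℕ} {R : Type*} [Zero R] (x : Fin ℓ → R) {i : ℕ} (h : ℓ ≤ i) :
    ext0 x i = 0 := dif_neg (by omega)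

/-- Extension by zero puts the last root `e_ℓ` in the same form as the differences `e_k - e_{k+1}`.
-/
theorem simpleRoot_dotProduct {ℓ : ℕ} (x : Fin ℓ → ℝ) (k : Fin ℓ) :
    simpleRoot k ⬝ᵥ x = ext0 x k - ext0 x (k + 1) := by
  rw [ext0_val]
  unfold simpleRoot
  split_ifs with h
  · rw [sub_dotProduct, single_one_dotProduct, single_one_dotProduct, ext0, dif_pos h]
  · rw [single_one_dotProduct, ext0_of_le x (by omega), sub_zero]

/-- Summation against the constants `b`, in terms of the differences of a sequence that vanishes
from `ℓ` on. -/
theorem sum_b_mul_sub {ℓ : ℕ} (hℓ : 1 ≤ ℓ) {R : Type*} [CommRing R] (f : ℕ → R) (h : f ℓ = 0) :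
    ∑ k : Fin ℓ, (b k.succ : R) * (f k - f (k + 1)) = f 0 + f 1 := by
  obtain ⟨j, rfl⟩ : ∃ j, ℓ = j + 1 := ⟨ℓ - 1, by omega⟩
  rw [Fin.sum_univ_succ]
  have h2 : ∀ k : Fin j, (b k.succ.succ : R) * (f (k.succ : Fin (j + 1)) -
      f ((k.succ : Fin (j + 1)) + 1)) = 2 * (f (k + 1) - f (k + 1 + 1)) := by
    intro k
    simp [b]
  rw [Finset.sum_congr rfl fun k _ => h2 k, ← Finset.mul_sum,
    Fin.sum_univ_eq_sum_range (fun k => f (k + 1) - f (k + 1 + 1)) j,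
    Finset.sum_range_sub' (fun k => f (k + 1)) j, h]
  simp [b]
  ring

theorem highestRoot_dotProduct {ℓ : ℕ} (hℓ : 1 ≤ ℓ) (x : Fin ℓ → ℝ) :
    highestRoot ℓ ⬝ᵥ x = ext0 x 0 + ext0 x 1 := by
  rw [highestRoot, sum_dotProduct]
  simp only [smul_dotProduct, simpleRoot_dotProduct, smul_eq_mul]
  exact sum_b_mul_sub hℓ (ext0 x) (ext0_of_le x le_rfl)

theorem ext0_div {ℓ : ℕ} (a : Fin ℓ → ℤ) (M : ℕ) (i : ℕ) :
    ext0 (fun i => (a i : ℝ) / M) i = ((ext0 a i : ℤ) : ℝ) / M := by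
  unfold ext0; split_ifs <;> simp

theorem div_mem_closedAlcove_iff {ℓ : ℕ} (hℓ : 1 ≤ ℓ) (a : Fin ℓ → ℤ) {M : ℕ} (hM : 0 < M) :
    (fun i => (a i : ℝ) / M) ∈ closedAlcove ℓ ↔
      (∀ k < ℓ, ext0 a (k + 1) ≤ ext0 a k) ∧ ext0 a 0 + ext0 a 1 ≤ M := by
  have hM' : (0 : ℝ) < M := Nat.cast_pos.2 hM
  simp only [closedAlcove, Set.mem_ofPred_eq, simpleRoot_dotProduct, highestRoot_dotProduct hℓ,
    ext0_div, ← add_div, div_le_one hM', sub_nonneg, div_le_div_iff_of_pos_right hM', Int.cast_le]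
  refine and_congr ⟨fun h k hk => h ⟨k, hk⟩, fun h k => h k k.2⟩ ?_
  exact_mod_cast Iff.rfl

/-- The labels that belong to a point of the alcove. -/
def labelsOf {ℓ : ℕ} (a : Fin ℓ → ℤ) (M : ℕ) : Fin (ℓ + 1) → ℤ :=
  Fin.cases (M - (ext0 a 0 + ext0 a 1)) fun k => ext0 a k - ext0 a (k + 1)

/-- The factor `b` cancels the denominator of the vertex, and the coweights turn the labels into
tail sums. -/
theorem sum_smul_vertex {ℓ : ℕ} (r : Fin (ℓ + 1) → ℤ) (M : ℕ) (i : Fin ℓ) :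
    (∑ k, ((r k : ℝ) * b k / M) • vertex k) i =
      ((∑ k ∈ Finset.Ico (i : ℕ) ℓ, ext0 (fun k : Fin ℓ => r k.succ) k : ℤ) : ℝ) / M := by
  rw [Fin.sum_univ_succ, Pi.add_apply, Finset.sum_apply]
  have h0 : vertex (0 : Fin (ℓ + 1)) = 0 := rfl
  have h1 : ∀ k : Fin ℓ, (((r k.succ : ℝ) * b k.succ / M) • vertex k.succ) i =
      if (i : ℕ) ≤ k then ((ext0 (fun k : Fin ℓ => r k.succ) k : ℤ) : ℝ) / M else 0 := by
    intro k
    have hb : (b k.succ : ℝ) ≠ 0 := by unfold b; split_ifs <;> norm_num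
    have hv : vertex k.succ = (1 / (b k.succ : ℝ)) • coweight k := rfl
    rw [hv, ext0_val]
    simp only [Pi.smul_apply, coweight, smul_eq_mul, Fin.le_def]
    split_ifs
    · field_simp
    · simp
  rw [h0, smul_zero, Pi.zero_apply, zero_add, Finset.sum_congr rfl fun k _ => h1 k,
    Fin.sum_univ_eq_sum_range (fun k => if (i : ℕ) ≤ k then
      ((ext0 (fun k : Fin ℓ => r k.succ) k : ℤ) : ℝ) / M else 0) ℓ, ← Finset.sum_filter,
    Int.cast_sum, Finset.sum_div]
  refine Finset.sum_congr ?_ fun _ _ => rfl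
  ext k
  simp only [Finset.mem_filter, Finset.mem_range, Finset.mem_Ico]
  tauto

theorem sum_mul_b {ℓ : ℕ} (hℓ : 1 ≤ ℓ) (a : Fin ℓ → ℤ) (r : Fin (ℓ + 1) → ℤ)
    (h : ∀ k : Fin ℓ, r k.succ = ext0 a k - ext0 a (k + 1)) :
    ∑ k, r k * b k = r 0 + (ext0 a 0 + ext0 a 1) := by
  rw [Fin.sum_univ_succ, ← sum_b_mul_sub hℓ (ext0 a) (ext0_of_le a le_rfl)]
  congr 1
  · simp [b]
  · exact Finset.sum_congr rfl fun k _ => by rw [h, mul_comm]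

/-- Coordinates are tail sums of labels, so consecutive differences recover all labels except that
of the affine node, which the total `M` then determines. -/
theorem barycentric_iff {ℓ : ℕ} (hℓ : 1 ≤ ℓ) (a : Fin ℓ → ℤ) (r : Fin (ℓ + 1) → ℤ) {M : ℕ}
    (hM : 0 < M) :
    ((fun i => (a i : ℝ) / M) = ∑ k, ((r k : ℝ) * b k / M) • vertex k ∧
      (M : ℤ) = ∑ k, r k * b k) ↔ r = labelsOf a M := by
  have hM' : (M : ℝ) ≠ 0 := Nat.cast_ne_zero.2 hM.ne'
  have hsum : ((fun i => (a i : ℝ) / M) = ∑ k, ((r k : ℝ) * b k / M) • vertex k) ↔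
      ∀ i ≤ ℓ, ext0 a i = ∑ k ∈ Finset.Ico i ℓ, ext0 (fun k : Fin ℓ => r k.succ) k := by
    rw [funext_iff]
    simp only [sum_smul_vertex, div_left_inj' hM', Int.cast_inj]
    constructor
    · intro h i hi
      rcases hi.eq_or_lt with rfl | hi
      · simp [ext0]
      · rw [← h ⟨i, hi⟩, ← ext0_val a]
    · intro h i
      rw [← h i i.2.le, ext0_val]
  have hdiff : ((fun i => (a i : ℝ) / M) = ∑ k, ((r k : ℝ) * b k / M) • vertex k) ↔
      ∀ k : Fin ℓ, r k.succ = ext0 a k - ext0 a (k + 1) := by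
    rw [hsum]
    constructor
    · intro h k
      rw [h k k.2.le, h (k + 1) k.2, Finset.sum_eq_sum_Ico_succ_bot k.2, add_sub_cancel_right,
        ext0_val]
    · intro h i hi
      induction hi using Nat.decreasingInduction with
      | self => simp [ext0]
      | of_succ i hi ih =>
        rw [Finset.sum_eq_sum_Ico_succ_bot hi, ← ih, ext0, dif_pos hi]
        have := h ⟨i, hi⟩
        simp only at this
        rw [show ext0 (fun k : Fin ℓ => r k.succ) i = r (Fin.succ ⟨i, hi⟩) from dif_pos hi, this,
          sub_add_cancel, ext0, dif_pos hi]
  rw [hdiff]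
  constructor
  · rintro ⟨h1, h2⟩
    rw [sum_mul_b hℓ a r h1] at h2
    funext k
    refine Fin.cases ?_ (fun k => ?_) k
    · change r 0 = M - (ext0 a 0 + ext0 a 1)
      omega
    · exact h1 k
  · rintro rfl
    refine ⟨fun k => rfl, ?_⟩
    rw [sum_mul_b hℓ a _ fun k => rfl]
    change (M : ℤ) = M - (ext0 a 0 + ext0 a 1) + _
    omega

theorem labelsOf_nonneg {ℓ : ℕ} {a : Fin ℓ → ℤ} {M : ℕ}
    (h : (∀ k < ℓ, ext0 a (k + 1) ≤ ext0 a k) ∧ ext0 a 0 + ext0 a 1 ≤ M) (k : Fin (ℓ + 1)) :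
    0 ≤ labelsOf a M k := by
  refine Fin.cases ?_ (fun k => ?_) k
  · exact sub_nonneg.2 h.2
  · exact sub_nonneg.2 (h.1 k k.2)

theorem ext0_sigmaVec {ℓ : ℕ} (p : ℓ.Partition) {i : ℕ} (hi : i < ℓ) :
    ext0 (sigmaVec p) i = sigma p (i + 1) := dif_pos hi

theorem labelsOf_sigmaVec {ℓ : ℕ} (hℓ : 2 ≤ ℓ) (p : ℓ.Partition) :
    labelsOf (sigmaVec p) (m p) = labels p := by
  funext k
  refine Fin.cases ?_ (fun k => ?_) k
  · change (m p : ℤ) - (ext0 (sigmaVec p) 0 + ext0 (sigmaVec p) 1) = _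
    rw [ext0_sigmaVec p (by omega), ext0_sigmaVec p (by omega)]
    simp [labels]
  · change ext0 (sigmaVec p) k - ext0 (sigmaVec p) (k + 1) = _
    rw [ext0_sigmaVec p k.2]
    simp only [labels, Fin.val_succ, Nat.succ_ne_zero, if_false]
    split_ifs with h
    · rw [ext0_sigmaVec p h]
    · have hk : (k : ℕ) + 1 = ℓ := by have := k.2; omega
      rw [ext0_of_le _ (by omega), sub_zero, hk]

theorem sigmaVec_alcove {ℓ : ℕ} (hℓ : 2 ≤ ℓ) (p : ℓ.Partition) :
    (∀ k < ℓ, ext0 (sigmaVec p) (k + 1) ≤ ext0 (sigmaVec p) k) ∧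
      ext0 (sigmaVec p) 0 + ext0 (sigmaVec p) 1 ≤ m p := by
  constructor
  · intro k hk
    unfold ext0
    rw [dif_pos hk]
    split_ifs with h
    · exact sigmaVec_antitone p (by simp [Fin.le_def])
    · exact sigmaVec_nonneg p _
  · unfold ext0
    rw [dif_pos (by omega), dif_pos (by omega)]
    have h0 := two_mul_sigmaVec_le p ⟨0, by omega⟩
    have h1 := two_mul_sigmaVec_le p ⟨1, by omega⟩
    omega

/-! ### Uniqueness of the point of the alcove -/

theorem antitone_of_ext0 {ℓ : ℕ} {a : Fin ℓ → ℤ} (h : ∀ k < ℓ, ext0 a (k + 1) ≤ ext0 a k) :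
    Antitone (ext0 a) := by
  refine antitone_nat_of_succ_le fun k => ?_
  by_cases hk : k < ℓ
  · exact h k hk
  · rw [ext0_of_le a (by omega), ext0_of_le a (by omega)]

theorem map_expo_eq_of_conj {ℓ : ℕ} {a c : Fin ℓ → ℤ} {ξ : ℂˣ} {h : SO ℓ}
    (hh : h⁻¹ * coch a ξ * h = coch c ξ) :
    Finset.univ.val.map (fun i => ξ ^ expo a i) = Finset.univ.val.map (fun i => ξ ^ expo c i) := by
  have hM : ((h⁻¹ : SL ℓ) : Mat ℓ) * ((coch a ξ : SL ℓ) : Mat ℓ) * ((h : SL ℓ) : Mat ℓ) =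
      ((coch c ξ : SL ℓ) : Mat ℓ) := by
    rw [← hh]; rfl
  have h1 : ((h : SL ℓ) : Mat ℓ) * ((h⁻¹ : SL ℓ) : Mat ℓ) = 1 := by
    rw [← Matrix.SpecialLinearGroup.coe_mul, mul_inv_cancel, Matrix.SpecialLinearGroup.coe_one]
  have hc := congrArg Matrix.charpoly hM
  rw [Matrix.charpoly_mul_comm, ← Matrix.mul_assoc, h1, Matrix.one_mul, coe_coch, coe_coch,
    Matrix.charpoly_diagonal, Matrix.charpoly_diagonal] at hc
  have := map_eq_of_prod_X_sub_C_eq hc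
  refine Multiset.map_injective Units.val_injective ?_
  rwa [Multiset.map_map, Multiset.map_map]

theorem eq_or_mul_eq_one_of_add_inv_eq {z w : ℂˣ}
    (h : (z : ℂ) + (z : ℂ)⁻¹ = (w : ℂ) + (w : ℂ)⁻¹) : z = w ∨ z * w = 1 := by
  have hz := z.ne_zero
  have hw := w.ne_zero
  field_simp at h
  have h' : ((z : ℂ) - w) * (z * w - 1) = 0 := by linear_combination h
  rcases mul_eq_zero.1 h' with h | h
  · exact Or.inl (Units.ext (sub_eq_zero.1 h))
  · exact Or.inr (Units.ext (by simpa using sub_eq_zero.1 h))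

/-- Equality of the sums means `ξ^x = ξ^y` or `ξ^(x+y) = 1`. Since `|x - y| ≤ M/2` and `0 ≤ x + y ≤
M`, either divisibility by `M` leaves only `x = y`. -/
theorem eq_of_add_inv_zpow_eq {ξ : ℂˣ} {M : ℕ} (hξ : IsPrimitiveRoot ξ M) {x y : ℤ} (hx : 0 ≤ x)
    (hy : 0 ≤ y) (hxM : 2 * x ≤ M) (hyM : 2 * y ≤ M)
    (h : ((ξ ^ x : ℂˣ) : ℂ) + ((ξ ^ x : ℂˣ) : ℂ)⁻¹ = ((ξ ^ y : ℂˣ) : ℂ) + ((ξ ^ y : ℂˣ) : ℂ)⁻¹) :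
    x = y := by
  rcases eq_or_mul_eq_one_of_add_inv_eq h with h | h
  · have h1 : ξ ^ (x - y) = 1 := by rw [_root_.zpow_sub, h, mul_inv_cancel]
    obtain ⟨q, hq⟩ := (hξ.zpow_eq_one_iff_dvd _).1 h1
    rcases lt_trichotomy q 0 with hq0 | rfl | hq0
    · nlinarith
    · omega
    · nlinarith
  · rw [← _root_.zpow_add] at h
    obtain ⟨q, hq⟩ := (hξ.zpow_eq_one_iff_dvd _).1 h
    rcases lt_trichotomy q 0 with hq0 | rfl | hq0
    · nlinarith
    · omega
    · nlinarith

/-- The function `z + z⁻¹` does not see the sign of an exponent. Applied to the spectrum it gives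
the middle value once and every other value twice; cancelling the former and halving multiplicities
leaves a multiset that determines the exponents. -/
theorem map_eq_of_map_expo_eq {ℓ : ℕ} {a c : Fin ℓ → ℤ} {ξ : ℂˣ} {M : ℕ}
    (hξ : IsPrimitiveRoot ξ M) (ha : ∀ i, 0 ≤ a i ∧ 2 * a i ≤ M) (hc : ∀ i, 0 ≤ c i ∧ 2 * c i ≤ M)
    (h : Finset.univ.val.map (fun i => ξ ^ expo a i) =
      Finset.univ.val.map (fun i => ξ ^ expo c i)) :
    Finset.univ.val.map a = Finset.univ.val.map c := by
  classical
  set F : ℂˣ → ℂ := fun z => (z : ℂ) + (z : ℂ)⁻¹ with hF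
  have hFinv : ∀ s : ℤ, F (ξ ^ (-s)) = F (ξ ^ s) := by
    intro s
    simp only [hF, _root_.zpow_neg, Units.val_inv_eq_inv_val, inv_inv, add_comm]
  have hprod : ∀ a : Fin ℓ → ℤ, ((Finset.univ.val.map (fun i => ξ ^ expo a i)).map
      fun z => X - C (F z)).prod = (X - C (F (ξ ^ (0 : ℤ)))) *
        (∏ i, (X - C (F (ξ ^ a i)))) ^ 2 := by
    intro a
    rw [Multiset.map_map]
    have := prod_expo a fun s => X - C (F (ξ ^ s))
    simp only [hFinv, ← pow_two, Finset.prod_pow] at this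
    exact this
  have hsq : (∏ i, (X - C (F (ξ ^ a i)))) ^ 2 = (∏ i, (X - C (F (ξ ^ c i)))) ^ 2 := by
    have h1 := hprod a
    rw [h, hprod c] at h1
    exact (mul_left_cancel₀ (X_sub_C_ne_zero _) h1).symm
  have hroots : Finset.univ.val.map (fun i => F (ξ ^ a i)) =
      Finset.univ.val.map (fun i => F (ξ ^ c i)) := by
    have h2 := congrArg roots hsq
    rw [roots_pow, roots_pow] at h2
    have h3 : ∀ a : Fin ℓ → ℤ, (∏ i, (X - C (F (ξ ^ a i)))).roots =
        Finset.univ.val.map (fun i => F (ξ ^ a i)) := by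
      intro a
      rw [← roots_multiset_prod_X_sub_C (Finset.univ.val.map (fun i => F (ξ ^ a i))),
        Multiset.map_map]
      rfl
    rw [h3, h3] at h2
    ext z
    have h4 := congrArg (Multiset.count z) h2
    rw [Multiset.count_nsmul, Multiset.count_nsmul] at h4
    omega
  obtain ⟨e, he⟩ := exists_equiv_of_map_eq hroots
  have hce : c ∘ e = a := funext fun i =>
    eq_of_add_inv_zpow_eq hξ (hc (e i)).1 (ha i).1 (hc (e i)).2 (ha i).2 (congrFun he i)
  rw [← hce, ← Multiset.map_map, Multiset.map_univ_val_equiv]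

theorem eq_of_antitone_of_map_eq {ℓ : ℕ} {a c : Fin ℓ → ℤ} (ha : Antitone a) (hc : Antitone c)
    (h : Finset.univ.val.map a = Finset.univ.val.map c) : a = c := by
  rw [Fin.univ_val_map, Fin.univ_val_map, Multiset.coe_eq_coe] at h
  exact List.ofFn_injective (h.eq_of_pairwise'
    (List.sortedGE_ofFn_iff.2 ha).pairwise (List.sortedGE_ofFn_iff.2 hc).pairwise)

/-- A point of the alcove at which some coordinate of the torus element is `-1` has all its
coordinates in the lower half of the interval. -/
theorem two_mul_le_of_alcove {ℓ : ℕ} {a : Fin ℓ → ℤ} {M : ℕ} (hM : 0 < M)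
    (hal : (∀ k < ℓ, ext0 a (k + 1) ≤ ext0 a k) ∧ ext0 a 0 + ext0 a 1 ≤ M)
    (hex : ∃ (i : Fin ℓ) (q : ℤ), 2 * a i = M * (2 * q + 1)) (i : Fin ℓ) :
    0 ≤ a i ∧ 2 * a i ≤ M := by
  have hanti := antitone_of_ext0 hal.1
  have hnn : ∀ j, 0 ≤ ext0 a j := fun j => by
    rw [← ext0_of_le a (Nat.le_add_right ℓ j)]; exact hanti (Nat.le_add_left j ℓ)
  have hi : ext0 a i ≤ ext0 a 0 := hanti (Nat.zero_le _)
  rw [← ext0_val a i]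
  refine ⟨hnn i, ?_⟩
  obtain ⟨j, q, hq⟩ := hex
  rw [← ext0_val a j] at hq
  have hj0 : ext0 a j ≤ ext0 a 0 := hanti (Nat.zero_le _)
  have h1 := hnn 1
  have hj := hnn j
  -- `2 aⱼ` is an odd multiple of `M` between `0` and `2 M`, hence equal to `M`.
  have hq0 : q = 0 := by
    have hMz : (0 : ℤ) < M := by exact_mod_cast hM
    have hle : 2 * ext0 a j ≤ 2 * M := by linarith [hal.2]
    rcases lt_trichotomy q 0 with h | h | h
    · nlinarith
    · exact h
    · nlinarith
  subst hq0
  -- Either the largest coordinate is itself `M/2`, or the second one is at least `M/2` and the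
  -- affine wall bounds the largest by `M/2`.
  rcases Nat.eq_zero_or_pos (j : ℕ) with h0 | h0
  · rw [h0] at hq; linarith
  · have : ext0 a j ≤ ext0 a 1 := hanti h0
    linarith [hal.2]

theorem eq_sigmaVec_of_conj {ℓ : ℕ} (hℓ : 2 ≤ ℓ) (p : ℓ.Partition) {ξ : ℂˣ}
    (hξ : IsPrimitiveRoot ξ (m p)) {a : Fin ℓ → ℤ} {h : SO ℓ}
    (hh : h⁻¹ * coch a ξ * h = coch (sigmaVec p) ξ)
    (hal : (∀ k < ℓ, ext0 a (k + 1) ≤ ext0 a k) ∧ ext0 a 0 + ext0 a 1 ≤ m p) :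
    a = sigmaVec p := by
  have hmap := map_expo_eq_of_conj hh
  have hex : ∃ (i : Fin ℓ) (q : ℤ), 2 * a i = m p * (2 * q + 1) := by
    obtain ⟨j, hj⟩ := exists_of_mem_sigmaMultiset (half_m_mem_sigmaMultiset (by omega) p)
    have hmem : ξ ^ ((m p / 2 : ℕ) : ℤ) ∈ Finset.univ.val.map (fun i => ξ ^ expo a i) := by
      rw [hmap, Multiset.mem_map]
      exact ⟨⟨j, by omega⟩, Finset.mem_univ_val _, by simp [expo, hj]⟩
    obtain ⟨i, -, hi⟩ := Multiset.mem_map.1 hmem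
    have h1 : ξ ^ (expo a i - ((m p / 2 : ℕ) : ℤ)) = 1 := by
      rw [_root_.zpow_sub, hi, mul_inv_cancel]
    obtain ⟨q, hq⟩ := (hξ.zpow_eq_one_iff_dvd _).1 h1
    have hhalf : 2 * ((m p / 2 : ℕ) : ℤ) = m p := by exact_mod_cast two_mul_half_m p
    have h2 : 2 * expo a i = m p * (2 * q + 1) := by linear_combination 2 * hq + hhalf
    have hm : (m p : ℤ) ≠ 0 := by exact_mod_cast (m_pos p).ne'
    unfold expo at h2
    split_ifs at h2 with h3 h4
    · exact ⟨_, q, h2⟩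
    -- In the mirrored half the exponent is negated, and `-(2q+1) = 2(-q-1)+1`. The middle exponent
    -- `0` is ruled out below, as it is not an odd multiple of `m/2`.
    · exact ⟨_, -q - 1, by linear_combination -h2⟩
    · rcases mul_eq_zero.1 (h2.symm.trans (mul_zero 2)) with h5 | h5
      · exact absurd h5 hm
      · omega
  have ha := two_mul_le_of_alcove (m_pos p) hal hex
  refine eq_of_antitone_of_map_eq ?_ (sigmaVec_antitone p)
    (map_eq_of_map_expo_eq hξ ha (fun i => ⟨sigmaVec_nonneg p i, two_mul_sigmaVec_le p i⟩) hmap)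
  intro i j hij
  rw [← ext0_val a i, ← ext0_val a j]
  exact antitone_of_ext0 hal.1 hij

end KacB

/-! ### The Kac diagram of `n` -/

theorem mainTheorem5 (ℓ : ℕ) (hℓ : 3 ≤ ℓ) (p : ℓ.Partition)
    (ξ : ℂˣ) (hξ : IsPrimitiveRoot ξ (KacB.m p)) (y : Fin (ℓ + 1) → ℤ) :
    KacB.IsKacDiagram ξ (KacB.n p) y ↔ y = KacB.reduce (KacB.labels p) := by
  have hord := KacB.orderOf_n (by omega) p hξ
  have hm := KacB.m_pos p
  obtain ⟨h₀, hh₀⟩ := KacB.exists_conj_n_eq_coch p hξ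
  have hlab := KacB.labelsOf_sigmaVec (by omega) p
  unfold KacB.IsKacDiagram
  rw [hord]
  constructor
  · rintro ⟨-, -, h, a, r, hh, hal, -, hbary, hsum, rfl⟩
    rw [KacB.div_mem_closedAlcove_iff (by omega) a hm] at hal
    have ha : a = KacB.sigmaVec p := by
      -- Both torus elements are conjugates of `n p`, by `h` and by `h₀`, so `h⁻¹ * h₀` conjugates
      -- one to the other.
      refine KacB.eq_sigmaVec_of_conj (h := h⁻¹ * h₀) (by omega) p hξ ?_ hal
      rw [← hh, ← hh₀]
      group
    rw [(KacB.barycentric_iff (by omega) a r hm).1 ⟨hbary, hsum⟩, ha, hlab]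
  · intro hy
    have hal := KacB.sigmaVec_alcove (by omega) p
    obtain ⟨hbary, hsum⟩ := (KacB.barycentric_iff (by omega) (KacB.sigmaVec p) _ hm).2 rfl
    refine ⟨hm, hξ, h₀, KacB.sigmaVec p, _, hh₀,
      (KacB.div_mem_closedAlcove_iff (by omega) _ hm).2 hal, KacB.labelsOf_nonneg hal, hbary, hsum,
      ?_⟩
    rw [hy, hlab]
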